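/- Let $n\ge 3$ and $R>0$, and let $z$ be uniformly distributed on the sphere $\mathbb S^{n-1}(R)\subset\mathbb R^n$ of radius $R$ centred at $0$, i.e. $z$ has the law of $R\zeta/\|\zeta\|_2$ with $\zeta\sim N(0,I_n)$. For $f=(f_1,\dots,f_n):\mathbb S^{n-1}(R)\to\mathbb R^n$ and $x\in\mathbb S^{n-1}(R)$, let $\nabla f(x)\in\mathbb R^{n\times n}$ be the matrix with entries $(\nabla f(x))_{ij}=\partial_i \check f_j(x)$, where $\check f(x)=f(Rx/\|x\|_2)$ for $x\neq0$ (so the columns of $\nabla f$ are the gradients on the sphere of $f_1,\dots,f_n$, defined wherever $\check f$ is differentiable). Let $P_x^\perp=I_n-xx^\top/\|x\|_2^2$. Assume that either * $f$ is locally Lipschitz on $\mathbb S^{n-1}(R)$ and $\mathbb E[\|\nabla f(z)^\top\|_F^2]<\infty$; or * $f=\tilde f/\|\tilde f\|_2$ at the points of $\mathbb S^{n-1}(R)$ where $\tilde f\ne0$, for some $\tilde f$ with values in $\mathbb R^n$ that is locally Lipschitz on $\mathbb S^{n-1}(R)$ (for instance, the restriction of a locally Lipschitz map $\mathbb R^n\to\mathbb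 R^n$) and satisfies $\mathbb P(\tilde f(z)\ne 0)=1$ and $\mathbb E[\|\tilde f(z)\|_2^{-2}\|\nabla\tilde f(z)\|_F^2]<\infty$. Define $\xi_f(z)=f(z)^\top z-R^2n^{-1}\operatorname{tr}(\nabla f(z)^\top P_z^\perp)$. Then $\check f$ is differentiable at $z$ with probability one, all expectations below are finite, and $$\mathbb E\big[(\xi_f(z)-\mathbb E[f(z)]^\top z)^2\big]\le 2R^4(n^2-2n)^{-1}\,\mathbb E\big[\|\nabla f(z)^\top P_z^\perp\|_F^2\big],$$ $$\Big(\mathbb E\big|\|f(z)\|_2-\|\mathbb E[f(z)]\|_2\big|\Big)^2\le R^2(n-2)^{-1}\,\mathbb E\big[\|\nabla f(z)^\top P_z^\perp\|_F^2\big],$$ and the second bound also holds with the left-hand side replaced by $\mathbb E\big[\big|\|f(z)\|_2-\|\mathbb E[f(z)]\|_2\big|^2\big]$. -/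

import Mathlib

open MeasureTheory ProbabilityTheory
open scoped Matrix

/-- The uniform distribution on the sphere of radius `R` centred at `0` in `ℝⁿ`: the law of
`R ζ / ‖ζ‖₂` where `ζ ∼ N(0, Iₙ)`. -/
noncomputable def sphereUniform (n : ℕ) (R : ℝ) : Measure (EuclideanSpace ℝ (Fin n)) :=
  (stdGaussian (EuclideanSpace ℝ (Fin n))).map (fun x => (R / ‖x‖) • x)

/-- The extension `x ↦ f (R x / ‖x‖₂)` of a function on the sphere of radius `R`, constant along
rays. It depends on `f` only through its values on the sphere (for `x ≠ 0`). -/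
noncomputable def radialExt {n : ℕ} (R : ℝ)
    (f : EuclideanSpace ℝ (Fin n) → EuclideanSpace ℝ (Fin n)) :
    EuclideanSpace ℝ (Fin n) → EuclideanSpace ℝ (Fin n) :=
  fun x => f ((R / ‖x‖) • x)

/-- The gradient matrix `∇f(x)` of a vector field `f = (f₁, …, fₙ)` on the sphere of radius `R`.
Its columns are `∇f₁(x), …, ∇fₙ(x)`: the entry `(i, j)` is the partial derivative with respect to
the `i`-th coordinate of the `j`-th component of the radially constant extension of `f`. -/
noncomputable def sphereGrad {n : ℕ} (R : ℝ)
    (f : EuclideanSpace ℝ (Fin n) → EuclideanSpace ℝ (Fin n)) (x : EuclideanSpace ℝ (Fin n)) :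
    Matrix (Fin n) (Fin n) ℝ :=
  Matrix.of fun i j => (fderiv ℝ (radialExt R f) x (EuclideanSpace.single i (1 : ℝ))) j

/-- The matrix `P_x^⊥ = Iₙ - x xᵀ / ‖x‖₂²`. -/
noncomputable def projPerp {n : ℕ} (x : EuclideanSpace ℝ (Fin n)) : Matrix (Fin n) (Fin n) ℝ :=
  1 - (‖x‖ ^ 2)⁻¹ • Matrix.of fun i j => x i * x j

/-- The squared Frobenius norm of a matrix. -/
def frobSq {n : ℕ} (A : Matrix (Fin n) (Fin n) ℝ) : ℝ :=
  ∑ i, ∑ j, A i j ^ 2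

/-- `ξ_f(x) = f(x)ᵀ x - R² n⁻¹ trace (∇f(x)ᵀ P_x^⊥)`. -/
noncomputable def xiStein {n : ℕ} (R : ℝ)
    (f : EuclideanSpace ℝ (Fin n) → EuclideanSpace ℝ (Fin n)) (x : EuclideanSpace ℝ (Fin n)) : ℝ :=
  inner ℝ (f x) x - R ^ 2 * (n : ℝ)⁻¹ * ((sphereGrad R f x)ᵀ * projPerp x).trace

/-!
For a smooth compactly supported vector field `g` and a standard Gaussian vector `X`, two
integrations by parts give `E (⟪g X, X⟫ - div g X)² = E ‖g X‖² + E tr (Dg X)²`, and rotating `X`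
into an independent copy gives the Poincaré inequality `E ‖g X - E g X‖² ≤ E ‖Dg X‖²`.
Mollification and cutoff to annuli extend both bounds to maps that are constant along rays and
Lipschitz on a sphere: such a map is bounded with derivative `O(1 / ‖x‖)`, which is square
integrable in dimension at least three. A quotient `g / ‖g‖` is the limit of truncated quotients of
this kind.

The norm and the direction of `X` are independent, so the bounds descend to the sphere through
`E ‖X‖² = n` and `E ‖X‖⁻² = 1 / (n - 2)`. In the Stein term, replacing the random ratio of the two
radial factors by the constant `R² / n` does not increase the second moment, because
`1 / n ≤ 1 / (n - 2)`.
-/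

section GaussianDensity

variable {E : Type*} [NormedAddCommGroup E] [InnerProductSpace ℝ E] [FiniteDimensional ℝ E]
  [MeasurableSpace E] [BorelSpace E]

variable (E) in
/-- The total mass `∫ exp (-‖x‖² / 2) dx` of the unnormalized Gaussian weight. -/
noncomputable def gaussMass : ℝ := ∫ x : E, Real.exp (-(1 / 2) * ‖x‖ ^ 2)

/-- The density of the standard Gaussian distribution with respect to Lebesgue measure. -/
noncomputable def gaussDensity (x : E) : ℝ := (gaussMass E)⁻¹ * Real.exp (-(1 / 2) * ‖x‖ ^ 2)

lemma gaussMass_pos : 0 < gaussMass E := by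
  rw [gaussMass, GaussianFourier.integral_rexp_neg_mul_sq_norm (by norm_num)]
  positivity

lemma gaussDensity_pos (x : E) : 0 < gaussDensity x :=
  mul_pos (inv_pos.2 gaussMass_pos) (Real.exp_pos _)

@[fun_prop]
lemma continuous_gaussDensity : Continuous (gaussDensity : E → ℝ) := by
  unfold gaussDensity; fun_prop

lemma integrable_gaussDensity : Integrable (gaussDensity : E → ℝ) :=
  (Integrable.of_integral_ne_zero (gaussMass_pos (E := E)).ne').const_mul _

lemma hasFDerivAt_gaussDensity (x : E) :
    HasFDerivAt (gaussDensity : E → ℝ) (-(gaussDensity x) • innerSL ℝ x) x := by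
  have hsq : HasFDerivAt (fun y : E => ‖y‖ ^ 2) (2 • innerSL ℝ x) x :=
    (hasStrictFDerivAt_norm_sq x).hasFDerivAt
  refine (((hsq.const_mul (-(1 / 2) : ℝ)).exp).const_mul (gaussMass E)⁻¹).congr_fderiv ?_
  ext y
  simp [gaussDensity]
  ring

lemma ofReal_gaussMass :
    (gaussMass E : ℂ) = (Real.pi / (1 / 2 : ℂ)) ^ (Module.finrank ℝ E / 2 : ℂ) := by
  rw [gaussMass, ← integral_complex_ofReal]
  simpa using GaussianFourier.integral_cexp_neg_mul_sq_norm_add (b := 1 / 2) (by norm_num) 0 (0 : E)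

lemma integral_gaussDensity_smul_cexp_inner (t : E) :
    ∫ x : E, gaussDensity x • Complex.exp (inner ℝ x t * Complex.I) =
      Complex.exp (-(‖t‖ ^ 2 / 2)) := by
  have hmass : (gaussMass E : ℂ) ≠ 0 := by exact_mod_cast gaussMass_pos.ne'
  have hintegrand (x : E) : gaussDensity x • Complex.exp (inner ℝ x t * Complex.I) =
      (gaussMass E : ℂ)⁻¹ *
        Complex.exp (-(1 / 2 : ℂ) * ‖x‖ ^ 2 + Complex.I * (inner ℝ t x : ℝ)) := by
    rw [gaussDensity, Complex.exp_add, real_inner_comm, Complex.real_smul]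
    push_cast
    rw [mul_comm Complex.I]
    ring
  have hfourier := GaussianFourier.integral_cexp_neg_mul_sq_norm_add (b := 1 / 2) (by norm_num)
    Complex.I t
  rw [← ofReal_gaussMass] at hfourier
  simp_rw [hintegrand]
  rw [integral_const_mul, hfourier, inv_mul_cancel_left₀ hmass]
  congr 1
  simp
  ring

theorem stdGaussian_eq_withDensity :
    stdGaussian E = volume.withDensity (fun x : E => ENNReal.ofReal (gaussDensity x)) := by
  have : IsFiniteMeasure (volume.withDensity (fun x : E => ENNReal.ofReal (gaussDensity x))) :=
    isFiniteMeasure_withDensity_ofReal integrable_gaussDensity.2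
  refine Measure.ext_of_charFun (funext fun t => ?_)
  rw [charFun_stdGaussian, charFun_apply, integral_withDensity_eq_integral_toReal_smul
    (continuous_gaussDensity.measurable.ennreal_ofReal) (by simp)]
  simp_rw [ENNReal.toReal_ofReal (gaussDensity_pos _).le]
  rw [integral_gaussDensity_smul_cexp_inner, neg_div]

lemma stdGaussian_absolutelyContinuous : stdGaussian E ≪ (volume : Measure E) := by
  rw [stdGaussian_eq_withDensity]
  exact withDensity_absolutelyContinuous _ _

lemma ae_ne_zero_stdGaussian [Nontrivial E] : ∀ᵐ x ∂stdGaussian E, x ≠ 0 :=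
  stdGaussian_absolutelyContinuous.ae_le (Measure.ae_ne volume 0)

variable {F : Type*} [NormedAddCommGroup F] [NormedSpace ℝ F]

lemma integral_stdGaussian (f : E → F) :
    ∫ x, f x ∂stdGaussian E = ∫ x, gaussDensity x • f x := by
  rw [stdGaussian_eq_withDensity, integral_withDensity_eq_integral_toReal_smul
    (continuous_gaussDensity.measurable.ennreal_ofReal) (by simp)]
  simp_rw [ENNReal.toReal_ofReal (gaussDensity_pos _).le]

lemma integrable_stdGaussian_iff {f : E → F} :
    Integrable f (stdGaussian E) ↔ Integrable fun x => gaussDensity x • f x := by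
  rw [stdGaussian_eq_withDensity, integrable_withDensity_iff_integrable_smul'
    (continuous_gaussDensity.measurable.ennreal_ofReal) (by simp)]
  simp_rw [ENNReal.toReal_ofReal (gaussDensity_pos _).le]

theorem integral_mul_inner_stdGaussian {u : E → ℝ} {a : E} (hu : Differentiable ℝ u)
    (hint : Integrable u (stdGaussian E))
    (hint_inner : Integrable (fun x => u x * inner ℝ a x) (stdGaussian E))
    (hint_fderiv : Integrable (fun x => fderiv ℝ u x a) (stdGaussian E)) :
    ∫ x, u x * inner ℝ a x ∂stdGaussian E = ∫ x, fderiv ℝ u x a ∂stdGaussian E := by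
  have hfderiv (x : E) :
      fderiv ℝ (gaussDensity : E → ℝ) x a = -(gaussDensity x * inner ℝ a x) := by
    rw [(hasFDerivAt_gaussDensity x).fderiv]
    simp [real_inner_comm]
  rw [integrable_stdGaussian_iff] at hint hint_inner hint_fderiv
  simp only [smul_eq_mul] at hint hint_inner hint_fderiv
  have hparts := integral_mul_fderiv_eq_neg_fderiv_mul_of_integrable (μ := (volume : Measure E))
    (f := u) (g := gaussDensity) (v := a)
    (by simpa only [mul_comm] using hint_fderiv)
    (by simpa only [hfderiv, mul_neg, mul_left_comm] using hint_inner.fun_neg)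
    (by simpa only [mul_comm] using hint)
    (fun x _ => hu x) (fun x _ => (hasFDerivAt_gaussDensity x).differentiableAt)
  simp only [hfderiv, mul_neg, integral_neg, neg_inj] at hparts
  simp only [integral_stdGaussian, smul_eq_mul, mul_left_comm (gaussDensity _), hparts]
  simp only [mul_comm]

lemma integrable_norm_pow_stdGaussian (k : ℕ) :
    Integrable (fun x : E => ‖x‖ ^ k) (stdGaussian E) :=
  (IsGaussian.memLp_id (stdGaussian E) k (by simp)).integrable_norm_pow'

end GaussianDensity

section HilbertSchmidt

variable {E : Type*} [NormedAddCommGroup E] [InnerProductSpace ℝ E] [FiniteDimensional ℝ E]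

variable (E) in
/-- The trace, as a continuous linear functional on the endomorphisms of a finite-dimensional
space. -/
noncomputable def traceCLM : (E →L[ℝ] E) →L[ℝ] ℝ :=
  LinearMap.toContinuousLinearMap (LinearMap.trace ℝ E ∘ₗ ContinuousLinearMap.coeLM ℝ)

lemma traceCLM_apply (L : E →L[ℝ] E) : traceCLM E L = LinearMap.trace ℝ E L := rfl

lemma traceCLM_eq_sum_inner {ι : Type*} [Fintype ι] (b : OrthonormalBasis ι ℝ E) (L : E →L[ℝ] E) :
    traceCLM E L = ∑ i, inner ℝ (b i) (L (b i)) :=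
  LinearMap.trace_eq_sum_inner _ b

lemma traceCLM_smulRight (φ : E →L[ℝ] ℝ) (v : E) : traceCLM E (φ.smulRight v) = φ v :=
  LinearMap.trace_smulRight φ.toLinearMap v

lemma traceCLM_comp_comm (L M : E →L[ℝ] E) : traceCLM E (L ∘L M) = traceCLM E (M ∘L L) :=
  LinearMap.trace_comp_comm' M.toLinearMap L.toLinearMap

variable {F : Type*} [NormedAddCommGroup F] [InnerProductSpace ℝ F] [CompleteSpace F]

/-- The Hilbert–Schmidt inner product `trace (L† M)` of linear maps out of a finite-dimensional
inner product space. -/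
noncomputable def hsInner (L M : E →L[ℝ] F) : ℝ := traceCLM E (L.adjoint ∘L M)

/-- The squared Hilbert–Schmidt norm `trace (L† L)`. -/
noncomputable def hsSq (L : E →L[ℝ] F) : ℝ := hsInner L L

lemma hsInner_eq_sum_inner {ι : Type*} [Fintype ι] (b : OrthonormalBasis ι ℝ E) (L M : E →L[ℝ] F) :
    hsInner L M = ∑ i, inner ℝ (L (b i)) (M (b i)) := by
  simp [hsInner, traceCLM_eq_sum_inner b, ContinuousLinearMap.adjoint_inner_right]

lemma hsSq_eq_sum_norm_sq {ι : Type*} [Fintype ι] (b : OrthonormalBasis ι ℝ E) (L : E →L[ℝ] F) :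
    hsSq L = ∑ i, ‖L (b i)‖ ^ 2 := by
  simp [hsSq, hsInner_eq_sum_inner b]

@[fun_prop]
lemma continuous_hsInner : Continuous fun p : (E →L[ℝ] F) × (E →L[ℝ] F) => hsInner p.1 p.2 := by
  simp only [hsInner_eq_sum_inner (stdOrthonormalBasis ℝ E)]
  fun_prop

@[fun_prop]
lemma continuous_hsSq : Continuous (hsSq : (E →L[ℝ] F) → ℝ) := by
  unfold hsSq; fun_prop

lemma hsSq_zero : hsSq (0 : E →L[ℝ] F) = 0 := by
  simp [hsSq_eq_sum_norm_sq (stdOrthonormalBasis ℝ E)]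

lemma hsSq_nonneg (L : E →L[ℝ] F) : 0 ≤ hsSq L := by
  rw [hsSq_eq_sum_norm_sq (stdOrthonormalBasis ℝ E)]
  positivity

lemma hsSq_smul (c : ℝ) (L : E →L[ℝ] F) : hsSq (c • L) = c ^ 2 * hsSq L := by
  simp [hsSq_eq_sum_norm_sq (stdOrthonormalBasis ℝ E), Finset.mul_sum, norm_smul, mul_pow]

lemma hsSq_adjoint (L : E →L[ℝ] E) : hsSq L.adjoint = hsSq L := by
  rw [hsSq, hsSq, hsInner, hsInner, ContinuousLinearMap.adjoint_adjoint, traceCLM_comp_comm]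

lemma hsSq_le (L : E →L[ℝ] F) : hsSq L ≤ Module.finrank ℝ E * ‖L‖ ^ 2 := by
  rw [hsSq_eq_sum_norm_sq (stdOrthonormalBasis ℝ E)]
  have hcol (i) : ‖L (stdOrthonormalBasis ℝ E i)‖ ^ 2 ≤ ‖L‖ ^ 2 := by
    gcongr
    simpa using L.le_opNorm (stdOrthonormalBasis ℝ E i)
  simpa using Finset.sum_le_card_nsmul Finset.univ _ _ fun i _ => hcol i

lemma norm_sq_le_hsSq (L : E →L[ℝ] F) : ‖L‖ ^ 2 ≤ hsSq L := by
  set b := stdOrthonormalBasis ℝ E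
  suffices ‖L‖ ≤ √(hsSq L) from
    (Real.le_sqrt (norm_nonneg L) (hsSq_nonneg L)).1 this
  refine L.opNorm_le_bound (Real.sqrt_nonneg _) fun x => ?_
  calc ‖L x‖ = ‖∑ i, inner ℝ (b i) x • L (b i)‖ := by
        conv_lhs => rw [← b.sum_repr' x]
        simp
    _ ≤ ∑ i, ‖inner ℝ (b i) x‖ * ‖L (b i)‖ :=
        (norm_sum_le _ _).trans_eq (by simp only [norm_smul])
    _ ≤ √(∑ i, ‖inner ℝ (b i) x‖ ^ 2) * √(∑ i, ‖L (b i)‖ ^ 2) :=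
        Real.sum_mul_le_sqrt_mul_sqrt _ _ _
    _ = √(hsSq L) * ‖x‖ := by
        rw [b.sum_sq_norm_inner_right, Real.sqrt_sq (norm_nonneg x), mul_comm,
          hsSq_eq_sum_norm_sq b]

lemma hsSq_comp_le {G : Type*} [NormedAddCommGroup G] [InnerProductSpace ℝ G] [CompleteSpace G]
    (A : F →L[ℝ] G) (L : E →L[ℝ] F) : hsSq (A ∘L L) ≤ ‖A‖ ^ 2 * hsSq L := by
  simp only [hsSq_eq_sum_norm_sq (stdOrthonormalBasis ℝ E), Finset.mul_sum, ← mul_pow]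
  gcongr
  exact A.le_opNorm _

lemma abs_hsInner_le (L M : E →L[ℝ] F) : |hsInner L M| ≤ (hsSq L + hsSq M) / 2 := by
  simp only [hsSq_eq_sum_norm_sq (stdOrthonormalBasis ℝ E),
    hsInner_eq_sum_inner (stdOrthonormalBasis ℝ E), ← Finset.sum_add_distrib, Finset.sum_div]
  refine (Finset.abs_sum_le_sum_abs _ _).trans (Finset.sum_le_sum fun i _ => ?_)
  refine (abs_real_inner_le_norm _ _).trans ?_
  linarith [two_mul_le_add_sq ‖L (stdOrthonormalBasis ℝ E i)‖ ‖M (stdOrthonormalBasis ℝ E i)‖]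

lemma traceCLM_comp_self_le_hsSq (L : E →L[ℝ] E) : traceCLM E (L ∘L L) ≤ hsSq L := by
  have h := (le_abs_self _).trans (abs_hsInner_le L.adjoint L)
  rwa [hsSq_adjoint, add_self_div_two, hsInner, ContinuousLinearMap.adjoint_adjoint] at h

end HilbertSchmidt

section GaussianDivergence

variable {E : Type*} [NormedAddCommGroup E] [InnerProductSpace ℝ E] [FiniteDimensional ℝ E]

/-- The Gaussian divergence `⟨G, x⟩ - div G`: the formal adjoint of the gradient in the Gaussian
`L²` space. -/
noncomputable def gaussDiv (G : E → E) (x : E) : ℝ :=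
  inner ℝ (G x) x - traceCLM E (fderiv ℝ G x)

lemma gaussDiv_id (x : E) : gaussDiv id x = ‖x‖ ^ 2 - Module.finrank ℝ E := by
  simp [gaussDiv, traceCLM_apply]

lemma gaussDiv_add {G H : E → E} {x : E} (hG : DifferentiableAt ℝ G x)
    (hH : DifferentiableAt ℝ H x) : gaussDiv (G + H) x = gaussDiv G x + gaussDiv H x := by
  simp only [gaussDiv, fderiv_add hG hH, map_add, Pi.add_apply, inner_add_left]
  ring

lemma gaussDiv_smul {u : E → ℝ} {G : E → E} {x : E} (hu : DifferentiableAt ℝ u x)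
    (hG : DifferentiableAt ℝ G x) :
    gaussDiv (u • G) x = u x * gaussDiv G x - fderiv ℝ u x (G x) := by
  simp only [gaussDiv, fderiv_smul hu hG, map_add, map_smul, traceCLM_smulRight, Pi.smul_apply',
    real_inner_smul_left, smul_eq_mul]
  ring

lemma contDiff_gaussDiv {g : E → E} (hg : ContDiff ℝ 2 g) : ContDiff ℝ 1 (gaussDiv g) :=
  ((hg.of_le one_le_two).inner ℝ contDiff_id).sub
    ((traceCLM E).contDiff.comp (hg.fderiv_right (by norm_num)))

lemma fderiv_gaussDiv {g : E → E} (hg : ContDiff ℝ 2 g) (x v : E) :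
    fderiv ℝ (gaussDiv g) x v = inner ℝ (fderiv ℝ g x v) x + inner ℝ (g x) v -
      traceCLM E (fderiv ℝ (fderiv ℝ g) x v) := by
  have hg₁ : DifferentiableAt ℝ g x := hg.differentiable two_ne_zero x
  have hg₂ : DifferentiableAt ℝ (fderiv ℝ g) x :=
    (hg.fderiv_right (m := 1) (by norm_num)).differentiable one_ne_zero x
  have h := (hg₁.hasFDerivAt.inner ℝ (hasFDerivAt_id x)).sub
    ((traceCLM E).hasFDerivAt.comp x hg₂.hasFDerivAt)
  rw [HasFDerivAt.fderiv (f := gaussDiv g) h]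
  simp [add_comm]

lemma gaussDiv_fderiv_apply_self {g : E → E} (hg : ContDiff ℝ 2 g) (x : E) :
    gaussDiv (fun y => fderiv ℝ g y (g y)) x = inner ℝ (fderiv ℝ g x (g x)) x -
      traceCLM E (fderiv ℝ (fderiv ℝ g) x (g x)) - traceCLM E (fderiv ℝ g x ∘L fderiv ℝ g x) := by
  have hg₁ : DifferentiableAt ℝ g x := hg.differentiable two_ne_zero x
  have hg₂ : DifferentiableAt ℝ (fderiv ℝ g) x :=
    (hg.fderiv_right (m := 1) (by norm_num)).differentiable one_ne_zero x
  have hsymm : (fderiv ℝ (fderiv ℝ g) x).flip (g x) = fderiv ℝ (fderiv ℝ g) x (g x) := by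
    ext w
    exact (hg.contDiffAt.isSymmSndFDerivAt (by simp)).eq w (g x)
  rw [gaussDiv, fderiv_clm_apply hg₂ hg₁, hsymm, map_add]
  ring

lemma gaussDiv_sq {g : E → E} (hg : ContDiff ℝ 2 g) (x : E) :
    gaussDiv g x ^ 2 = ‖g x‖ ^ 2 + traceCLM E (fderiv ℝ g x ∘L fderiv ℝ g x) +
      gaussDiv (gaussDiv g • g + fun y => fderiv ℝ g y (g y)) x := by
  have hg₁ : DifferentiableAt ℝ g x := hg.differentiable two_ne_zero x
  have hg₂ : DifferentiableAt ℝ (fderiv ℝ g) x :=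
    (hg.fderiv_right (m := 1) (by norm_num)).differentiable one_ne_zero x
  have hdiv : DifferentiableAt ℝ (gaussDiv g) x :=
    (contDiff_gaussDiv hg).differentiable one_ne_zero x
  rw [gaussDiv_add (hdiv.smul hg₁) (hg₂.clm_apply hg₁),
    gaussDiv_smul hdiv hg₁, fderiv_gaussDiv hg, gaussDiv_fderiv_apply_self hg,
    real_inner_self_eq_norm_sq]
  ring

variable [MeasurableSpace E] [BorelSpace E]

theorem integral_gaussDiv {G : E → E} (hG : Differentiable ℝ G)
    (hint : Integrable G (stdGaussian E))
    (hint_norm : Integrable (fun x => ‖G x‖ * ‖x‖) (stdGaussian E))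
    (hint_fderiv : Integrable (fderiv ℝ G) (stdGaussian E)) :
    ∫ x, gaussDiv G x ∂stdGaussian E = 0 := by
  set b := stdOrthonormalBasis ℝ E
  have hcoord (i) (x) :
      fderiv ℝ (fun y => inner ℝ (b i) (G y)) x (b i) = inner ℝ (b i) (fderiv ℝ G x (b i)) := by
    simp [fderiv_inner_apply, hG x]
  have hintegrable_fderiv (i) :
      Integrable (fun x => inner ℝ (b i) (fderiv ℝ G x (b i))) (stdGaussian E) :=
    (hint_fderiv.apply_continuousLinearMap (b i)).const_inner _
  have hintegrable_mul (i) :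
      Integrable (fun x => inner ℝ (b i) (G x) * inner ℝ (b i) x) (stdGaussian E) := by
    refine hint_norm.mono' ((hint.const_inner (b i)).aestronglyMeasurable.mul
      (by fun_prop)) (.of_forall fun x => ?_)
    rw [norm_mul]
    gcongr <;> simpa using norm_inner_le_norm (𝕜 := ℝ) (b i) _
  have hstein (i) : ∫ x, inner ℝ (b i) (G x) * inner ℝ (b i) x ∂stdGaussian E =
      ∫ x, inner ℝ (b i) (fderiv ℝ G x (b i)) ∂stdGaussian E := by
    simp_rw [← hcoord]
    exact integral_mul_inner_stdGaussian (fun x => (differentiableAt_const _).inner ℝ (hG x))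
      (hint.const_inner _) (hintegrable_mul i) (by simpa only [hcoord] using hintegrable_fderiv i)
  have hdiv (x) : gaussDiv G x = ∑ i, (inner ℝ (b i) (G x) * inner ℝ (b i) x -
      inner ℝ (b i) (fderiv ℝ G x (b i))) := by
    rw [gaussDiv, traceCLM_eq_sum_inner b, ← b.sum_inner_mul_inner, Finset.sum_sub_distrib]
    simp only [real_inner_comm]
  simp_rw [hdiv]
  rw [integral_finsetSum _ fun i _ => (hintegrable_mul i).sub' (hintegrable_fderiv i)]
  exact Finset.sum_eq_zero fun i _ => by
    rw [integral_sub (hintegrable_mul i) (hintegrable_fderiv i), hstein, sub_self]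

theorem integral_norm_sq_stdGaussian : ∫ x, ‖x‖ ^ 2 ∂stdGaussian E = Module.finrank ℝ E := by
  have h := integral_gaussDiv (G := (id : E → E)) differentiable_id IsGaussian.integrable_id
    (by simpa only [id, ← sq] using integrable_norm_pow_stdGaussian (E := E) 2)
    ((integrable_const (ContinuousLinearMap.id ℝ E)).congr (.of_forall fun x => fderiv_id.symm))
  simp_rw [gaussDiv_id] at h
  rw [integral_sub (integrable_norm_pow_stdGaussian 2) (integrable_const _), sub_eq_zero] at h
  simpa using h

lemma integrable_gaussDiv_of_hasCompactSupport {G : E → E} (hG : ContDiff ℝ 1 G)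
    (hG_supp : HasCompactSupport G) : Integrable (gaussDiv G) (stdGaussian E) := by
  have hfderiv : Continuous (fderiv ℝ G) := hG.continuous_fderiv one_ne_zero
  refine Continuous.integrable_of_hasCompactSupport (hf := ?_) ?_
  · exact (hG.continuous.inner continuous_id).sub ((traceCLM E).continuous.comp hfderiv)
  · exact (hG_supp.mono fun x hx h => hx (by simp [h])).sub
      ((hG_supp.fderiv ℝ).comp_left (map_zero (traceCLM E)))

lemma integral_gaussDiv_of_hasCompactSupport {G : E → E} (hG : ContDiff ℝ 1 G)
    (hG_supp : HasCompactSupport G) : ∫ x, gaussDiv G x ∂stdGaussian E = 0 :=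
  integral_gaussDiv (hG.differentiable one_ne_zero)
    (hG.continuous.integrable_of_hasCompactSupport hG_supp)
    ((hG.continuous.norm.mul continuous_norm).integrable_of_hasCompactSupport
      hG_supp.norm.mul_right)
    ((hG.continuous_fderiv one_ne_zero).integrable_of_hasCompactSupport (hG_supp.fderiv ℝ))

lemma integrable_comp_of_hasCompactSupport {X F G : Type*} [TopologicalSpace X]
    [MeasurableSpace X] [OpensMeasurableSpace X] {μ : Measure X} [IsFiniteMeasureOnCompacts μ]
    [TopologicalSpace F] [Zero F] [NormedAddCommGroup G] {φ : F → G} {f : X → F}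
    (hφ : Continuous φ) (hφ_zero : φ 0 = 0) (hf : Continuous f) (hf_supp : HasCompactSupport f) :
    Integrable (fun x => φ (f x)) μ :=
  (hφ.comp hf).integrable_of_hasCompactSupport (hf_supp.comp_left hφ_zero)

theorem integral_gaussDiv_sq {g : E → E} (hg : ContDiff ℝ 2 g) (hg_supp : HasCompactSupport g) :
    ∫ x, gaussDiv g x ^ 2 ∂stdGaussian E =
      ∫ x, ‖g x‖ ^ 2 ∂stdGaussian E +
        ∫ x, traceCLM E (fderiv ℝ g x ∘L fderiv ℝ g x) ∂stdGaussian E := by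
  have hfderiv : Continuous (fderiv ℝ g) := hg.continuous_fderiv two_ne_zero
  have hint_norm : Integrable (fun x => ‖g x‖ ^ 2) (stdGaussian E) :=
    integrable_comp_of_hasCompactSupport (φ := fun y => ‖y‖ ^ 2) (by fun_prop) (by simp)
      hg.continuous hg_supp
  have hint_trace : Integrable (fun x => traceCLM E (fderiv ℝ g x ∘L fderiv ℝ g x))
      (stdGaussian E) :=
    integrable_comp_of_hasCompactSupport (φ := fun L => traceCLM E (L ∘L L)) (by fun_prop)
      (by simp) hfderiv (hg_supp.fderiv ℝ)
  set H : E → E := gaussDiv g • g + fun y => fderiv ℝ g y (g y) with hH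
  have hH_smooth : ContDiff ℝ 1 H :=
    ((contDiff_gaussDiv hg).smul (hg.of_le one_le_two)).add
      ((hg.fderiv_right (by norm_num)).clm_apply (hg.of_le one_le_two))
  have hH_supp : HasCompactSupport H :=
    hg_supp.smul_left.add (hg_supp.mono fun x hx h => hx (by simp [h]))
  simp_rw [gaussDiv_sq hg]
  rw [← hH, integral_add (hint_norm.fun_add hint_trace)
    (integrable_gaussDiv_of_hasCompactSupport hH_smooth hH_supp), integral_add hint_norm hint_trace,
    integral_gaussDiv_of_hasCompactSupport hH_smooth hH_supp, add_zero]

theorem integral_gaussDiv_sq_le {g : E → E} (hg : ContDiff ℝ 2 g) (hg_supp : HasCompactSupport g) :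
    ∫ x, gaussDiv g x ^ 2 ∂stdGaussian E ≤
      ∫ x, ‖g x‖ ^ 2 ∂stdGaussian E + ∫ x, hsSq (fderiv ℝ g x) ∂stdGaussian E := by
  have hfderiv : Continuous (fderiv ℝ g) := hg.continuous_fderiv two_ne_zero
  rw [integral_gaussDiv_sq hg hg_supp]
  refine add_le_add_right (integral_mono ?_ ?_ fun x => traceCLM_comp_self_le_hsSq _) _
  · exact integrable_comp_of_hasCompactSupport (φ := fun L => traceCLM E (L ∘L L)) (by fun_prop)
      (by simp) hfderiv (hg_supp.fderiv ℝ)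
  · exact integrable_comp_of_hasCompactSupport continuous_hsSq hsSq_zero hfderiv
      (hg_supp.fderiv ℝ)

end GaussianDivergence

section SecondMoment

variable {α F : Type*} [MeasurableSpace α] [NormedAddCommGroup F] [InnerProductSpace ℝ F]
  [CompleteSpace F] {μ : Measure α} {g : α → F}

lemma integral_inner_integral (hg : Integrable g μ) :
    ∫ x, inner ℝ (g x) (∫ y, g y ∂μ) ∂μ = ‖∫ x, g x ∂μ‖ ^ 2 := by
  rw [← real_inner_self_eq_norm_sq, ← integral_inner hg]
  exact integral_congr_ae (.of_forall fun x => real_inner_comm _ _)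

lemma integral_norm_sub_integral_sq [IsProbabilityMeasure μ] (hg : MemLp g 2 μ) :
    ∫ x, ‖g x - ∫ y, g y ∂μ‖ ^ 2 ∂μ = ∫ x, ‖g x‖ ^ 2 ∂μ - ‖∫ x, g x ∂μ‖ ^ 2 := by
  have hg_int : Integrable g μ := hg.integrable one_le_two
  have hsq : Integrable (fun x => ‖g x‖ ^ 2) μ := hg.integrable_norm_pow two_ne_zero
  have hcross : Integrable (fun x => 2 * inner ℝ (g x) (∫ y, g y ∂μ)) μ :=
    (hg_int.inner_const _).const_mul 2
  simp only [norm_sub_sq_real]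
  rw [integral_add (hsq.sub' hcross) (integrable_const _), integral_sub hsq hcross,
    integral_const_mul, integral_inner_integral hg_int, integral_const, probReal_univ, one_smul]
  ring

end SecondMoment

section GaussianPoincare

variable {E F : Type*} [NormedAddCommGroup E] [InnerProductSpace ℝ E] [FiniteDimensional ℝ E]
  [MeasurableSpace E] [BorelSpace E] [NormedAddCommGroup F] [InnerProductSpace ℝ F]
  [CompleteSpace F]

theorem integral_inner_clm_stdGaussian (L : E →L[ℝ] F) {G : E → F} (hG : Differentiable ℝ G)
    (hint : Integrable G (stdGaussian E))
    (hint_norm : Integrable (fun x => ‖G x‖ * ‖x‖) (stdGaussian E))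
    (hint_fderiv : Integrable (fderiv ℝ G) (stdGaussian E)) :
    ∫ x, inner ℝ (G x) (L x) ∂stdGaussian E = ∫ x, hsInner L (fderiv ℝ G x) ∂stdGaussian E := by
  have hfderiv : fderiv ℝ (L.adjoint ∘ G) = fun x => L.adjoint ∘L fderiv ℝ G x :=
    funext fun x => (L.adjoint.hasFDerivAt.comp x (hG x).hasFDerivAt).fderiv
  have hint_fderiv' : Integrable (fun x => L.adjoint ∘L fderiv ℝ G x) (stdGaussian E) :=
    (ContinuousLinearMap.compL ℝ E F E L.adjoint).integrable_comp hint_fderiv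
  have hint_inner : Integrable (fun x => inner ℝ (G x) (L x)) (stdGaussian E) := by
    refine (hint_norm.const_mul ‖L‖).mono'
      (hint.aestronglyMeasurable.inner L.continuous.aestronglyMeasurable) (.of_forall fun x => ?_)
    calc ‖inner ℝ (G x) (L x)‖ ≤ ‖G x‖ * (‖L‖ * ‖x‖) :=
          (norm_inner_le_norm _ _).trans (by gcongr; exact L.le_opNorm x)
      _ = ‖L‖ * (‖G x‖ * ‖x‖) := by ring
  have hint_adjoint : Integrable (fun x => ‖(L.adjoint ∘ G) x‖ * ‖x‖) (stdGaussian E) := by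
    refine (hint_norm.const_mul ‖L.adjoint‖).mono' ((L.adjoint.integrable_comp
      hint).aestronglyMeasurable.norm.mul (by fun_prop)) (.of_forall fun x => ?_)
    rw [norm_mul, norm_norm, norm_norm, ← mul_assoc]
    gcongr
    exact L.adjoint.le_opNorm _
  have hdiv (x) : gaussDiv (L.adjoint ∘ G) x = inner ℝ (G x) (L x) - hsInner L (fderiv ℝ G x) := by
    rw [gaussDiv, hfderiv, hsInner, Function.comp_apply, ContinuousLinearMap.adjoint_inner_left]
  have hzero := integral_gaussDiv (L.adjoint.differentiable.comp hG)
    (L.adjoint.integrable_comp hint) hint_adjoint (by rwa [hfderiv])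
  simp_rw [hdiv] at hzero
  have hint_hsInner : Integrable (fun x => hsInner L (fderiv ℝ G x)) (stdGaussian E) :=
    (traceCLM E).integrable_comp hint_fderiv'
  rw [integral_sub hint_inner hint_hsInner] at hzero
  exact sub_eq_zero.1 hzero

lemma measurePreserving_rotation_stdGaussian (θ : ℝ) :
    MeasurePreserving (ContinuousLinearMap.rotation θ : E × E →L[ℝ] E × E)
      ((stdGaussian E).prod (stdGaussian E)) ((stdGaussian E).prod (stdGaussian E)) :=
  ⟨by fun_prop, IsGaussian.map_rotation_eq_self (by simp) θ⟩

omit [CompleteSpace F] in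
lemma integral_comp_rotation_stdGaussian (θ : ℝ) {Φ : E × E → F} (hΦ : Continuous Φ) :
    ∫ p : E × E, Φ (Real.cos θ • p.1 + Real.sin θ • p.2, -Real.sin θ • p.1 + Real.cos θ • p.2)
      ∂(stdGaussian E).prod (stdGaussian E) = ∫ p, Φ p ∂(stdGaussian E).prod (stdGaussian E) := by
  conv_rhs => rw [← (measurePreserving_rotation_stdGaussian (E := E) θ).map_eq]
  rw [integral_map (by fun_prop) hΦ.aestronglyMeasurable]
  rfl

omit [FiniteDimensional ℝ E] [MeasurableSpace E] [BorelSpace E] in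
lemma cos_smul_rotation_sub_sin_smul_rotation (θ : ℝ) (x y : E) :
    Real.cos θ • (Real.cos θ • x + Real.sin θ • y) -
      Real.sin θ • (-Real.sin θ • x + Real.cos θ • y) = x :=
  calc _ = (Real.sin θ ^ 2 + Real.cos θ ^ 2) • x := by module
    _ = x := by rw [Real.sin_sq_add_cos_sq, one_smul]

omit [FiniteDimensional ℝ E] [MeasurableSpace E] [BorelSpace E] in
lemma norm_neg_sin_smul_add_cos_smul_le (θ : ℝ) (x y : E) :
    ‖-Real.sin θ • x + Real.cos θ • y‖ ≤ ‖x‖ + ‖y‖ := by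
  refine (norm_add_le _ _).trans (add_le_add ?_ ?_)
  · rw [norm_smul, norm_neg]
    exact mul_le_of_le_one_left (norm_nonneg _) (Real.abs_sin_le_one θ)
  · rw [norm_smul]
    exact mul_le_of_le_one_left (norm_nonneg _) (Real.abs_cos_le_one θ)

lemma integrable_norm_add_norm_prod_stdGaussian :
    Integrable (fun p : E × E => ‖p.1‖ + ‖p.2‖) ((stdGaussian E).prod (stdGaussian E)) := by
  have h : Integrable (fun x : E => ‖x‖) (stdGaussian E) := IsGaussian.integrable_id.norm
  exact (h.comp_fst _).add (h.comp_snd _)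

/-- The interpolation `E⟪g X, g (cos θ X + sin θ Y)⟫`, with `X` and `Y` independent standard
Gaussian vectors, between `E ‖g X‖²` at `θ = 0` and `‖E g X‖²` at `θ = π / 2`. -/
noncomputable def gaussInterp (g : E → F) (θ : ℝ) : ℝ :=
  ∫ p : E × E, inner ℝ (g p.1) (g (Real.cos θ • p.1 + Real.sin θ • p.2))
    ∂(stdGaussian E).prod (stdGaussian E)

omit [CompleteSpace F] in
lemma gaussInterp_zero (g : E → F) : gaussInterp g 0 = ∫ x, ‖g x‖ ^ 2 ∂stdGaussian E := by
  simp [gaussInterp, integral_fun_fst (fun x => ‖g x‖ ^ 2)]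

lemma gaussInterp_pi_div_two {g : E → F} (hg : Integrable g (stdGaussian E)) :
    gaussInterp g (Real.pi / 2) = ‖∫ x, g x ∂stdGaussian E‖ ^ 2 := by
  have hint : Integrable (fun p : E × E => inner ℝ (g p.1) (g p.2))
      ((stdGaussian E).prod (stdGaussian E)) :=
    (hg.norm.mul_prod hg.norm).mono'
      (hg.aestronglyMeasurable.comp_fst.inner hg.aestronglyMeasurable.comp_snd)
      (.of_forall fun p => norm_inner_le_norm _ _)
  simp only [gaussInterp, Real.cos_pi_div_two, zero_smul, Real.sin_pi_div_two, one_smul, zero_add]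
  rw [integral_prod _ hint]
  simp only [integral_inner hg, integral_inner_integral hg]

variable {g : E → F} (hg : ContDiff ℝ 1 g) (hg_supp : HasCompactSupport g)
include hg hg_supp

omit [CompleteSpace F] in
lemma hasDerivAt_gaussInterp (θ : ℝ) :
    HasDerivAt (gaussInterp g)
      (∫ p : E × E, inner ℝ (g p.1) (fderiv ℝ g (Real.cos θ • p.1 + Real.sin θ • p.2)
        (-Real.sin θ • p.1 + Real.cos θ • p.2)) ∂(stdGaussian E).prod (stdGaussian E)) θ := by
  have hg_cont := hg.continuous
  have hfderiv_cont : Continuous (fderiv ℝ g) := hg.continuous_fderiv one_ne_zero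
  obtain ⟨M, hM⟩ := hg_cont.bounded_above_of_compact_support hg_supp
  obtain ⟨C, hC⟩ := hfderiv_cont.bounded_above_of_compact_support (hg_supp.fderiv ℝ)
  have hM_nonneg : 0 ≤ M := (norm_nonneg _).trans (hM 0)
  refine (hasDerivAt_integral_of_dominated_loc_of_deriv_le (s := Set.univ)
    (bound := fun p : E × E => M * (C * (‖p.1‖ + ‖p.2‖)))
    (F' := fun t p => inner ℝ (g p.1) (fderiv ℝ g (Real.cos t • p.1 + Real.sin t • p.2)
      (-Real.sin t • p.1 + Real.cos t • p.2))) Filter.univ_mem ?_ ?_ ?_ ?_ ?_ ?_).2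
  · exact .of_forall fun t => Continuous.aestronglyMeasurable (by fun_prop)
  · refine Integrable.of_bound (Continuous.aestronglyMeasurable (by fun_prop)) (M * M)
      (.of_forall fun p => (norm_inner_le_norm _ _).trans ?_)
    gcongr <;> exact hM _
  · exact Continuous.aestronglyMeasurable (by fun_prop)
  · refine .of_forall fun p t _ => (norm_inner_le_norm _ _).trans ?_
    gcongr
    · exact hM _
    · exact ContinuousLinearMap.le_of_opNorm_le_of_le _ (hC _)
        (norm_neg_sin_smul_add_cos_smul_le _ _ _)
  · exact (integrable_norm_add_norm_prod_stdGaussian.const_mul C).const_mul M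
  · refine .of_forall fun p t _ => ?_
    have hpath : HasDerivAt (fun t : ℝ => Real.cos t • p.1 + Real.sin t • p.2)
        (-Real.sin t • p.1 + Real.cos t • p.2) t :=
      ((Real.hasDerivAt_cos t).smul_const _).add ((Real.hasDerivAt_sin t).smul_const _)
    exact (innerSL ℝ (g p.1)).hasFDerivAt.comp_hasDerivAt t
      (((hg.differentiable one_ne_zero _).hasFDerivAt).comp_hasDerivAt t hpath)

lemma integrable_hsInner_fderiv_prod (θ : ℝ) :
    Integrable (fun p : E × E => hsInner (fderiv ℝ g p.1)
      (fderiv ℝ g (Real.cos θ • p.1 - Real.sin θ • p.2)))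
      ((stdGaussian E).prod (stdGaussian E)) := by
  have hfderiv_cont : Continuous (fderiv ℝ g) := hg.continuous_fderiv one_ne_zero
  obtain ⟨B, hB⟩ : ∃ B, ∀ x, ‖hsSq (fderiv ℝ g x)‖ ≤ B :=
    (continuous_hsSq.comp hfderiv_cont).bounded_above_of_compact_support
      ((hg_supp.fderiv ℝ).comp_left hsSq_zero)
  refine Integrable.of_bound (Continuous.aestronglyMeasurable (by fun_prop)) B
    (.of_forall fun p => (abs_hsInner_le _ _).trans ?_)
  linarith [(le_abs_self _).trans (hB p.1),
    (le_abs_self _).trans (hB (Real.cos θ • p.1 - Real.sin θ • p.2))]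

lemma integral_inner_fderiv_stdGaussian (θ : ℝ) (x : E) :
    ∫ y, inner ℝ (g (Real.cos θ • x - Real.sin θ • y)) (fderiv ℝ g x y) ∂stdGaussian E =
      ∫ y, -Real.sin θ * hsInner (fderiv ℝ g x) (fderiv ℝ g (Real.cos θ • x - Real.sin θ • y))
        ∂stdGaussian E := by
  have hg_cont := hg.continuous
  have hfderiv_cont : Continuous (fderiv ℝ g) := hg.continuous_fderiv one_ne_zero
  obtain ⟨M, hM⟩ := hg_cont.bounded_above_of_compact_support hg_supp
  obtain ⟨C, hC⟩ := hfderiv_cont.bounded_above_of_compact_support (hg_supp.fderiv ℝ)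
  have hderiv (y) : HasFDerivAt (fun y => g (Real.cos θ • x - Real.sin θ • y))
      (-Real.sin θ • fderiv ℝ g (Real.cos θ • x - Real.sin θ • y)) y := by
    refine ((hg.differentiable one_ne_zero _).hasFDerivAt.comp y
      (((hasFDerivAt_id y).const_smul (Real.sin θ)).const_sub (Real.cos θ • x))).congr_fderiv ?_
    ext
    simp
  have hfderiv : fderiv ℝ (fun y => g (Real.cos θ • x - Real.sin θ • y)) =
      fun y => -Real.sin θ • fderiv ℝ g (Real.cos θ • x - Real.sin θ • y) :=
    funext fun y => (hderiv y).fderiv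
  have hint : Integrable (fun y => g (Real.cos θ • x - Real.sin θ • y)) (stdGaussian E) :=
    Integrable.of_bound (Continuous.aestronglyMeasurable (by fun_prop)) M (.of_forall fun y => hM _)
  rw [integral_inner_clm_stdGaussian _ (fun y => (hderiv y).differentiableAt) hint]
  · simp [hfderiv, hsInner]
  · have hnorm : Integrable (fun y : E => ‖y‖) (stdGaussian E) := IsGaussian.integrable_id.norm
    exact hnorm.bdd_mul (c := M) hint.aestronglyMeasurable.norm
      (.of_forall fun y => (norm_norm _).trans_le (hM _))
  · rw [hfderiv]
    refine Integrable.of_bound (C := ‖-Real.sin θ‖ * C)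
      (Continuous.aestronglyMeasurable (by fun_prop)) (.of_forall fun y => ?_)
    rw [norm_smul]
    gcongr
    exact hC _

/-- Integration by parts in `Y`, after the rotation that turns the derivative of the path
`cos θ X + sin θ Y` into an independent copy of `X`. -/
lemma deriv_gaussInterp (θ : ℝ) :
    deriv (gaussInterp g) θ = -Real.sin θ * ∫ p : E × E, hsInner (fderiv ℝ g p.1)
      (fderiv ℝ g (Real.cos θ • p.1 - Real.sin θ • p.2))
        ∂(stdGaussian E).prod (stdGaussian E) := by
  have hg_cont := hg.continuous
  have hfderiv_cont : Continuous (fderiv ℝ g) := hg.continuous_fderiv one_ne_zero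
  obtain ⟨M, hM⟩ := hg_cont.bounded_above_of_compact_support hg_supp
  obtain ⟨C, hC⟩ := hfderiv_cont.bounded_above_of_compact_support (hg_supp.fderiv ℝ)
  have hM_nonneg : 0 ≤ M := (norm_nonneg _).trans (hM 0)
  have hrotate := integral_comp_rotation_stdGaussian θ (Φ := fun p : E × E =>
    inner ℝ (g (Real.cos θ • p.1 - Real.sin θ • p.2)) (fderiv ℝ g p.1 p.2)) (by fun_prop)
  simp only [cos_smul_rotation_sub_sin_smul_rotation] at hrotate
  have hint : Integrable (fun p : E × E => inner ℝ (g (Real.cos θ • p.1 - Real.sin θ • p.2))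
      (fderiv ℝ g p.1 p.2)) ((stdGaussian E).prod (stdGaussian E)) := by
    refine ((integrable_norm_add_norm_prod_stdGaussian.const_mul C).const_mul M).mono'
      (Continuous.aestronglyMeasurable (by fun_prop))
      (.of_forall fun p => (norm_inner_le_norm _ _).trans ?_)
    gcongr
    · exact hM _
    · exact ContinuousLinearMap.le_of_opNorm_le_of_le _ (hC _)
        (le_add_of_nonneg_left (norm_nonneg _))
  rw [(hasDerivAt_gaussInterp hg hg_supp θ).deriv, hrotate, integral_prod _ hint]
  simp_rw [integral_inner_fderiv_stdGaussian hg hg_supp θ]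
  rw [← integral_const_mul, integral_prod _
    ((integrable_hsInner_fderiv_prod hg hg_supp θ).const_mul _)]

lemma integral_hsInner_fderiv_prod_le (θ : ℝ) :
    ∫ p : E × E, hsInner (fderiv ℝ g p.1) (fderiv ℝ g (Real.cos θ • p.1 - Real.sin θ • p.2))
        ∂(stdGaussian E).prod (stdGaussian E) ≤ ∫ x, hsSq (fderiv ℝ g x) ∂stdGaussian E := by
  have hfderiv_cont : Continuous (fderiv ℝ g) := hg.continuous_fderiv one_ne_zero
  have hint : Integrable (fun x => hsSq (fderiv ℝ g x)) (stdGaussian E) :=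
    integrable_comp_of_hasCompactSupport continuous_hsSq hsSq_zero hfderiv_cont
      (hg_supp.fderiv ℝ)
  have hfst : Integrable (fun p : E × E => hsSq (fderiv ℝ g p.1))
      ((stdGaussian E).prod (stdGaussian E)) := hint.comp_fst _
  have hfst_integral : ∫ p : E × E, hsSq (fderiv ℝ g p.1) ∂(stdGaussian E).prod (stdGaussian E) =
      ∫ x, hsSq (fderiv ℝ g x) ∂stdGaussian E := by
    simp [integral_fun_fst (fun x => hsSq (fderiv ℝ g x))]
  have hrot_integral := integral_comp_rotation_stdGaussian θ (Φ := fun p : E × E =>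
    hsSq (fderiv ℝ g (Real.cos θ • p.1 - Real.sin θ • p.2))) (by fun_prop)
  have hrot : Integrable (fun p : E × E =>
      hsSq (fderiv ℝ g (Real.cos θ • p.1 - Real.sin θ • p.2)))
      ((stdGaussian E).prod (stdGaussian E)) := by
    rw [← (measurePreserving_rotation_stdGaussian θ).integrable_comp
      (Continuous.aestronglyMeasurable (by fun_prop))]
    exact hfst.congr (.of_forall fun p => congrArg (fun x => hsSq (fderiv ℝ g x))
      (cos_smul_rotation_sub_sin_smul_rotation θ p.1 p.2).symm)
  simp only [cos_smul_rotation_sub_sin_smul_rotation, hfst_integral] at hrot_integral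
  calc _ ≤ ∫ p : E × E, (hsSq (fderiv ℝ g p.1) +
          hsSq (fderiv ℝ g (Real.cos θ • p.1 - Real.sin θ • p.2))) / 2
          ∂(stdGaussian E).prod (stdGaussian E) :=
        integral_mono (integrable_hsInner_fderiv_prod hg hg_supp θ) ((hfst.add hrot).div_const 2)
          fun p => (le_abs_self _).trans (abs_hsInner_le _ _)
    _ = ∫ x, hsSq (fderiv ℝ g x) ∂stdGaussian E := by
        rw [integral_div, integral_add hfst hrot, hfst_integral, ← hrot_integral]
        ring

lemma integral_norm_sq_sub_norm_integral_sq_le :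
    ∫ x, ‖g x‖ ^ 2 ∂stdGaussian E - ‖∫ x, g x ∂stdGaussian E‖ ^ 2 ≤
      ∫ x, hsSq (fderiv ℝ g x) ∂stdGaussian E := by
  set A := ∫ x, hsSq (fderiv ℝ g x) ∂stdGaussian E
  have hderiv (θ) : HasDerivAt (fun θ => gaussInterp g θ - A * Real.cos θ)
      (deriv (gaussInterp g) θ - A * -Real.sin θ) θ :=
    (hasDerivAt_gaussInterp hg hg_supp θ).differentiableAt.hasDerivAt.sub
      ((Real.hasDerivAt_cos θ).const_mul A)
  have hmono : MonotoneOn (fun θ => gaussInterp g θ - A * Real.cos θ)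
      (Set.Icc 0 (Real.pi / 2)) := by
    refine monotoneOn_of_deriv_nonneg (convex_Icc _ _)
      (fun θ _ => (hderiv θ).continuousAt.continuousWithinAt)
      (fun θ _ => (hderiv θ).differentiableAt.differentiableWithinAt) fun θ hθ => ?_
    rw [interior_Icc] at hθ
    rw [(hderiv θ).deriv, deriv_gaussInterp hg hg_supp]
    have hsin : 0 ≤ Real.sin θ :=
      Real.sin_nonneg_of_nonneg_of_le_pi hθ.1.le (by linarith [hθ.2, Real.pi_pos])
    linarith [mul_le_mul_of_nonneg_left (integral_hsInner_fderiv_prod_le hg hg_supp θ) hsin]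
  have hends := hmono (Set.left_mem_Icc.2 Real.pi_div_two_pos.le)
    (Set.right_mem_Icc.2 Real.pi_div_two_pos.le) Real.pi_div_two_pos.le
  simp only [gaussInterp_zero, Real.cos_zero, Real.cos_pi_div_two, gaussInterp_pi_div_two
    (hg.continuous.integrable_of_hasCompactSupport hg_supp)] at hends
  linarith

theorem poincare_stdGaussian :
    ∫ x, ‖g x - ∫ y, g y ∂stdGaussian E‖ ^ 2 ∂stdGaussian E ≤
      ∫ x, hsSq (fderiv ℝ g x) ∂stdGaussian E := by
  have hg_cont := hg.continuous
  rw [integral_norm_sub_integral_sq (hg_cont.memLp_of_hasCompactSupport hg_supp)]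
  exact integral_norm_sq_sub_norm_integral_sq_le hg hg_supp

end GaussianPoincare

section SteinPoincare

open scoped Topology
open Filter

lemma tendsto_integral_norm_sq_of_norm_le {α F : Type*} [MeasurableSpace α]
    [NormedAddCommGroup F] {μ : Measure α} [IsFiniteMeasure μ] {G : ℕ → α → F} {g : α → F} {M : ℝ}
    (hG : ∀ k, AEStronglyMeasurable (G k) μ) (hM : ∀ k, ∀ᵐ x ∂μ, ‖G k x‖ ≤ M)
    (hlim : ∀ᵐ x ∂μ, Tendsto (fun k => G k x) atTop (𝓝 (g x))) :
    Tendsto (fun k => ∫ x, ‖G k x‖ ^ 2 ∂μ) atTop (𝓝 (∫ x, ‖g x‖ ^ 2 ∂μ)) := by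
  refine tendsto_integral_of_dominated_convergence (fun _ => M ^ 2)
    (fun k => (hG k).norm.pow 2) (integrable_const _) (fun k => ?_)
    (hlim.mono fun x hx => hx.norm.pow 2)
  filter_upwards [hM k] with x hx
  rw [norm_pow, norm_norm]
  gcongr

variable {E : Type*} [NormedAddCommGroup E] [InnerProductSpace ℝ E] [FiniteDimensional ℝ E]
  [MeasurableSpace E] [BorelSpace E]

omit [BorelSpace E] in
lemma tendsto_integral_hsSq {G' : ℕ → E → E →L[ℝ] E} {g' : E → E →L[ℝ] E} {w : E → ℝ}
    {μ : Measure E} (hG' : ∀ k, AEStronglyMeasurable (G' k) μ)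
    (hw : ∀ k, ∀ᵐ x ∂μ, ‖G' k x‖ ≤ w x) (hw_int : Integrable (fun x => w x ^ 2) μ)
    (hlim : ∀ᵐ x ∂μ, Tendsto (fun k => G' k x) atTop (𝓝 (g' x))) :
    Tendsto (fun k => ∫ x, hsSq (G' k x) ∂μ) atTop (𝓝 (∫ x, hsSq (g' x) ∂μ)) := by
  refine tendsto_integral_of_dominated_convergence (fun x => Module.finrank ℝ E * w x ^ 2)
    (fun k => continuous_hsSq.comp_aestronglyMeasurable (hG' k)) (hw_int.const_mul _) (fun k => ?_)
    (hlim.mono fun x hx => (continuous_hsSq.tendsto _).comp hx)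
  filter_upwards [hw k] with x hx
  rw [Real.norm_of_nonneg (hsSq_nonneg _)]
  refine (hsSq_le _).trans ?_
  gcongr

omit [MeasurableSpace E] [BorelSpace E] in
lemma inner_sub_traceCLM_sq_le {M w : ℝ} {v : E} {L : E →L[ℝ] E} (hv : ‖v‖ ≤ M) (hL : ‖L‖ ≤ w)
    (x : E) : (inner ℝ v x - traceCLM E L) ^ 2 ≤
      2 * (M ^ 2 * ‖x‖ ^ 2) + 2 * (‖traceCLM E‖ ^ 2 * w ^ 2) := by
  have hinner : (inner ℝ v x) ^ 2 ≤ M ^ 2 * ‖x‖ ^ 2 := by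
    rw [← mul_pow, ← sq_abs]
    gcongr
    exact (abs_real_inner_le_norm _ _).trans (by gcongr)
  have htrace : (traceCLM E L) ^ 2 ≤ ‖traceCLM E‖ ^ 2 * w ^ 2 := by
    rw [← mul_pow, ← sq_abs]
    gcongr
    exact (traceCLM E).le_opNorm_of_le hL
  linarith [sq_nonneg (inner ℝ v x + traceCLM E L)]

lemma tendsto_integral_inner_sub_traceCLM_sq {G : ℕ → E → E} {G' : ℕ → E → E →L[ℝ] E} {g : E → E}
    {g' : E → E →L[ℝ] E} {M : ℝ} {w : E → ℝ} {μ : Measure E}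
    (hμ : Integrable (fun x => ‖x‖ ^ 2) μ)
    (hG : ∀ k, AEStronglyMeasurable (G k) μ) (hG' : ∀ k, AEStronglyMeasurable (G' k) μ)
    (hM : ∀ k, ∀ᵐ x ∂μ, ‖G k x‖ ≤ M) (hw : ∀ k, ∀ᵐ x ∂μ, ‖G' k x‖ ≤ w x)
    (hw_int : Integrable (fun x => w x ^ 2) μ)
    (hlim : ∀ᵐ x ∂μ, Tendsto (fun k => G k x) atTop (𝓝 (g x)))
    (hlim' : ∀ᵐ x ∂μ, Tendsto (fun k => G' k x) atTop (𝓝 (g' x))) :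
    Tendsto (fun k => ∫ x, (inner ℝ (G k x) x - traceCLM E (G' k x)) ^ 2 ∂μ) atTop
      (𝓝 (∫ x, (inner ℝ (g x) x - traceCLM E (g' x)) ^ 2 ∂μ)) := by
  refine tendsto_integral_of_dominated_convergence
    (fun x => 2 * (M ^ 2 * ‖x‖ ^ 2) + 2 * (‖traceCLM E‖ ^ 2 * w x ^ 2))
    (fun k => (((hG k).inner aestronglyMeasurable_id).sub
      ((traceCLM E).continuous.comp_aestronglyMeasurable (hG' k))).pow 2)
    (((hμ.const_mul _).const_mul _).add ((hw_int.const_mul _).const_mul _)) (fun k => ?_) ?_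
  · filter_upwards [hM k, hw k] with x hx hx'
    rw [Real.norm_of_nonneg (sq_nonneg _)]
    exact inner_sub_traceCLM_sq_le hx hx' x
  · filter_upwards [hlim, hlim'] with x hx hx'
    exact ((hx.inner tendsto_const_nhds).sub (((traceCLM E).continuous.tendsto _).comp hx')).pow 2

/-- The map `g`, with (weak) derivative `g'`, satisfies the Gaussian Poincaré inequality and the
second-moment bound for the Stein divergence `⟪g x, x⟫ - tr (g' x)`. The derivative is a separate
argument so that the two bounds pass to limits of smooth maps. -/
structure SteinPoincare (g : E → E) (g' : E → E →L[ℝ] E) : Prop where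
  poincare : ∫ x, ‖g x - ∫ y, g y ∂stdGaussian E‖ ^ 2 ∂stdGaussian E ≤
    ∫ x, hsSq (g' x) ∂stdGaussian E
  stein : ∫ x, (inner ℝ (g x) x - traceCLM E (g' x)) ^ 2 ∂stdGaussian E ≤
    ∫ x, ‖g x‖ ^ 2 ∂stdGaussian E + ∫ x, hsSq (g' x) ∂stdGaussian E

lemma SteinPoincare.of_contDiff {g : E → E} (hg : ContDiff ℝ 2 g) (hg_supp : HasCompactSupport g) :
    SteinPoincare g (fderiv ℝ g) where
  poincare := poincare_stdGaussian (hg.of_le one_le_two) hg_supp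
  stein := integral_gaussDiv_sq_le hg hg_supp

omit [BorelSpace E] in
lemma SteinPoincare.congr_ae {g₁ g₂ : E → E} {g₁' g₂' : E → E →L[ℝ] E} (h : SteinPoincare g₁ g₁')
    (hg : g₁ =ᵐ[stdGaussian E] g₂) (hg' : g₁' =ᵐ[stdGaussian E] g₂') : SteinPoincare g₂ g₂' := by
  have hhs : ∫ x, hsSq (g₁' x) ∂stdGaussian E = ∫ x, hsSq (g₂' x) ∂stdGaussian E :=
    integral_congr_ae (hg'.fun_comp hsSq)
  have hvar : ∫ x, ‖g₁ x - ∫ y, g₁ y ∂stdGaussian E‖ ^ 2 ∂stdGaussian E =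
      ∫ x, ‖g₂ x - ∫ y, g₂ y ∂stdGaussian E‖ ^ 2 ∂stdGaussian E := by
    rw [integral_congr_ae hg]
    exact integral_congr_ae (hg.fun_comp (‖· - _‖ ^ 2))
  have hnorm : ∫ x, ‖g₁ x‖ ^ 2 ∂stdGaussian E = ∫ x, ‖g₂ x‖ ^ 2 ∂stdGaussian E :=
    integral_congr_ae (hg.fun_comp (‖·‖ ^ 2))
  have hdiv : ∫ x, (inner ℝ (g₁ x) x - traceCLM E (g₁' x)) ^ 2 ∂stdGaussian E =
      ∫ x, (inner ℝ (g₂ x) x - traceCLM E (g₂' x)) ^ 2 ∂stdGaussian E :=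
    integral_congr_ae <| by filter_upwards [hg, hg'] with x hx hx'; rw [hx, hx']
  exact ⟨hvar ▸ hhs ▸ h.poincare, hnorm ▸ hdiv ▸ hhs ▸ h.stein⟩

theorem SteinPoincare.of_tendsto {G : ℕ → E → E} {G' : ℕ → E → E →L[ℝ] E} {g : E → E}
    {g' : E → E →L[ℝ] E} {M : ℝ} {w : E → ℝ} (h : ∀ k, SteinPoincare (G k) (G' k))
    (hG : ∀ k, AEStronglyMeasurable (G k) (stdGaussian E))
    (hG' : ∀ k, AEStronglyMeasurable (G' k) (stdGaussian E))
    (hM : ∀ k, ∀ᵐ x ∂stdGaussian E, ‖G k x‖ ≤ M)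
    (hw : ∀ k, ∀ᵐ x ∂stdGaussian E, ‖G' k x‖ ≤ w x)
    (hw_int : Integrable (fun x => w x ^ 2) (stdGaussian E))
    (hlim : ∀ᵐ x ∂stdGaussian E, Tendsto (fun k => G k x) atTop (𝓝 (g x)))
    (hlim' : ∀ᵐ x ∂stdGaussian E, Tendsto (fun k => G' k x) atTop (𝓝 (g' x))) :
    SteinPoincare g g' := by
  have hmean : Tendsto (fun k => ∫ y, G k y ∂stdGaussian E) atTop (𝓝 (∫ y, g y ∂stdGaussian E)) :=
    tendsto_integral_of_dominated_convergence (fun _ => M) hG (integrable_const _) hM hlim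
  have hmean_le (k) : ‖∫ y, G k y ∂stdGaussian E‖ ≤ M := by
    simpa using norm_integral_le_of_norm_le_const (hM k)
  have hhs := tendsto_integral_hsSq hG' hw hw_int hlim'
  have hvar := tendsto_integral_norm_sq_of_norm_le (M := M + M)
    (fun k => (hG k).sub aestronglyMeasurable_const)
    (fun k => (hM k).mono fun x hx => (norm_sub_le _ _).trans (add_le_add hx (hmean_le k)))
    (hlim.mono fun x hx => hx.sub hmean)
  have hstein := tendsto_integral_inner_sub_traceCLM_sq (integrable_norm_pow_stdGaussian 2)
    hG hG' hM hw hw_int hlim hlim'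
  exact ⟨le_of_tendsto_of_tendsto' hvar hhs fun k => (h k).poincare,
    le_of_tendsto_of_tendsto' hstein
      ((tendsto_integral_norm_sq_of_norm_le hG hM hlim).add hhs) fun k => (h k).stein⟩

end SteinPoincare

section Mollification

open scoped ContDiff Topology Convolution
open Filter

variable {E F : Type*} [NormedAddCommGroup E]

/-- The bump functions at the origin supported in the ball of radius `2 / (k + 1)`. -/
noncomputable def shrinkingBump (k : ℕ) : ContDiffBump (0 : E) where
  rIn := 1 / (k + 1)
  rOut := 2 * (1 / (k + 1))
  rIn_pos := by positivity
  rIn_lt_rOut := by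
    have : (0 : ℝ) < 1 / (k + 1) := by positivity
    linarith

lemma tendsto_shrinkingBump_rOut :
    Tendsto (fun k => (shrinkingBump (E := E) k).rOut) atTop (𝓝 0) := by
  simpa [shrinkingBump] using (tendsto_one_div_add_atTop_nhds_zero_nat (𝕜 := ℝ)).const_mul 2

variable [InnerProductSpace ℝ E] [FiniteDimensional ℝ E] [MeasurableSpace E] [BorelSpace E]
  [NormedAddCommGroup F] [NormedSpace ℝ F]

lemma hasFDerivAt_convolution_of_lipschitzWith [FiniteDimensional ℝ F]
    {K : NNReal} {φ : E → ℝ} (hφ : Integrable φ) {g : E → F} {M : ℝ} (hM : ∀ x, ‖g x‖ ≤ M)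
    (hg : LipschitzWith K g) (x : E) :
    HasFDerivAt (φ ⋆[ContinuousLinearMap.lsmul ℝ ℝ, volume] g)
      ((φ ⋆[ContinuousLinearMap.lsmul ℝ ℝ, volume] (fderiv ℝ g)) x) x := by
  borelize F
  have hg_meas (y : E) : AEStronglyMeasurable (fun t => g (y - t)) volume :=
    (hg.continuous.comp (continuous_const.sub continuous_id)).aestronglyMeasurable
  refine (hasFDerivAt_integral_of_dominated_loc_of_lip (μ := (volume : Measure E))
    (F := fun x t => φ t • g (x - t)) (F' := fun t => φ t • fderiv ℝ g (x - t))
    (bound := fun t => |φ t| * K) (s := Set.univ) univ_mem ?_ ?_ ?_ ?_ ?_ ?_).2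
  · exact .of_forall fun y => hφ.aestronglyMeasurable.smul (hg_meas y)
  · exact hφ.smul_bdd M (hg_meas x) (.of_forall fun t => hM _)
  · refine hφ.aestronglyMeasurable.smul (Measurable.aestronglyMeasurable ?_)
    exact (measurable_fderiv ℝ g).comp (measurable_const.sub measurable_id)
  · refine .of_forall fun t => LipschitzOnWith.of_dist_le_mul fun y _ z _ => ?_
    rw [dist_eq_norm, ← smul_sub, norm_smul, Real.coe_nnabs, abs_mul, abs_abs, mul_assoc,
      Real.norm_eq_abs, NNReal.abs_eq]
    gcongr
    simpa [dist_eq_norm] using hg.dist_le_mul (y - t) (z - t)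
  · exact hφ.abs.mul_const _
  · have hdiff : ∀ᵐ t, DifferentiableAt ℝ g (x - t) :=
      (volume.measurePreserving_sub_left x).quasiMeasurePreserving.ae
        (hg.ae_differentiableAt (μ := (volume : Measure E)))
    filter_upwards [hdiff] with t ht
    have hshift : HasFDerivAt (fun y => g (y - t)) (fderiv ℝ g (x - t)) x :=
      ht.hasFDerivAt.comp x ((hasFDerivAt_id x).sub_const t)
    exact hshift.const_smul (φ t)

/-- The convolution with the `k`-th shrinking bump function. -/
noncomputable def mollify (k : ℕ) (v : E → F) : E → F :=
  (shrinkingBump k).normed volume ⋆[ContinuousLinearMap.lsmul ℝ ℝ, volume] v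

lemma norm_mollify_le (k : ℕ) {v : E → F} {C : ℝ} (hC : ∀ x, ‖v x‖ ≤ C) (x : E) :
    ‖mollify k v x‖ ≤ C := by
  calc ‖mollify k v x‖ ≤ ∫ t, (shrinkingBump (E := E) k).normed volume t * C := by
        refine norm_integral_le_of_norm_le ((shrinkingBump k).integrable_normed.mul_const C)
          (.of_forall fun t => ?_)
        rw [ContinuousLinearMap.lsmul_apply, norm_smul,
          Real.norm_of_nonneg ((shrinkingBump k).nonneg_normed t)]
        exact mul_le_mul_of_nonneg_left (hC _) ((shrinkingBump k).nonneg_normed t)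
    _ = C := by rw [integral_mul_const, (shrinkingBump k).integral_normed, one_mul]

lemma contDiff_mollify (k : ℕ) {v : E → F} (hv : Continuous v) : ContDiff ℝ ∞ (mollify k v) :=
  (shrinkingBump k).hasCompactSupport_normed.contDiff_convolution_left _
    (shrinkingBump k).contDiff_normed hv.locallyIntegrable

lemma hasCompactSupport_mollify (k : ℕ) {v : E → F} (hv : HasCompactSupport v) :
    HasCompactSupport (mollify k v) :=
  (shrinkingBump k).hasCompactSupport_normed.convolution _ hv

lemma tendsto_mollify [CompleteSpace F] {v : E → F} (hv : Continuous v) (x : E) :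
    Tendsto (fun k => mollify k v x) atTop (𝓝 (v x)) :=
  ContDiffBump.convolution_tendsto_right_of_continuous tendsto_shrinkingBump_rOut hv x

lemma ae_tendsto_mollify [CompleteSpace F] {v : E → F} (hv : LocallyIntegrable v) :
    ∀ᵐ x, Tendsto (fun k => mollify k v x) atTop (𝓝 (v x)) :=
  ContDiffBump.ae_convolution_tendsto_right_of_locallyIntegrable
    tendsto_shrinkingBump_rOut (K := 2) (.of_forall fun _ => le_rfl) hv

lemma fderiv_mollify [FiniteDimensional ℝ F] (k : ℕ) {K : NNReal} {v : E → F} {M : ℝ}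
    (hM : ∀ x, ‖v x‖ ≤ M) (hv : LipschitzWith K v) (x : E) :
    fderiv ℝ (mollify k v) x = mollify k (fderiv ℝ v) x :=
  (hasFDerivAt_convolution_of_lipschitzWith (shrinkingBump k).integrable_normed hM hv x).fderiv

theorem SteinPoincare.of_lipschitzWith {g : E → E} {K : NNReal} (hg : LipschitzWith K g)
    (hg_supp : HasCompactSupport g) : SteinPoincare g (fderiv ℝ g) := by
  obtain ⟨M, hM⟩ := hg.continuous.bounded_above_of_compact_support hg_supp
  have hfderiv_le (x) : ‖fderiv ℝ g x‖ ≤ K := norm_fderiv_le_of_lipschitz ℝ hg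
  have hfderiv_locInt : LocallyIntegrable (fderiv ℝ g) (volume : Measure E) :=
    (locallyIntegrable_const (K : ℝ)).mono (measurable_fderiv ℝ g).aestronglyMeasurable
      (.of_forall fun x => by simpa using hfderiv_le x)
  have hsmooth (k) := contDiff_mollify k hg.continuous
  refine SteinPoincare.of_tendsto (M := M) (w := fun _ => (K : ℝ)) (G := fun k => mollify k g)
    (fun k => SteinPoincare.of_contDiff (contDiff_infty.1 (hsmooth k) 2)
      (hasCompactSupport_mollify k hg_supp))
    (fun k => (hsmooth k).continuous.aestronglyMeasurable)
    (fun k => ((hsmooth k).continuous_fderiv (by simp)).aestronglyMeasurable)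
    (fun k => .of_forall fun x => norm_mollify_le k hM x)
    (fun k => .of_forall fun x => ?_) (integrable_const _)
    (.of_forall fun x => tendsto_mollify hg.continuous x) ?_
  · rw [fderiv_mollify k hM hg]
    exact norm_mollify_le k hfderiv_le x
  · refine stdGaussian_absolutelyContinuous.ae_le ?_
    filter_upwards [ae_tendsto_mollify hfderiv_locInt] with x hx
    simpa only [fderiv_mollify _ hM hg] using hx

end Mollification

section AnnularCutoff

open scoped ContDiff Topology
open Filter

variable {E F : Type*} [NormedAddCommGroup E]

/-- A smooth bump function on the line which is `1` on `[-1, 1]` and `0` off `(-2, 2)`. -/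
noncomputable def lineBump : ContDiffBump (0 : ℝ) := ⟨1, 2, one_pos, one_lt_two⟩

/-- A smooth cutoff to an annulus; these exhaust `E \ {0}` as `k` tends to infinity. -/
noncomputable def annularCutoff (k : ℕ) (x : E) : ℝ :=
  lineBump ((k + 1 : ℝ)⁻¹ * ‖x‖ ^ 2) - lineBump ((k + 1 : ℝ) * ‖x‖ ^ 2)

lemma annularCutoff_zero (k : ℕ) : annularCutoff k (0 : E) = 0 := by
  simp [annularCutoff]

lemma abs_annularCutoff_le_one (k : ℕ) (x : E) : |annularCutoff k x| ≤ 1 :=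
  abs_sub_le_of_nonneg_of_le lineBump.nonneg lineBump.le_one lineBump.nonneg lineBump.le_one

lemma lineBump_eq_one {t : ℝ} (ht₀ : 0 ≤ t) (ht : t ≤ 1) : lineBump t = 1 :=
  lineBump.one_of_mem_closedBall <| by
    rwa [Metric.mem_closedBall, dist_zero_right, Real.norm_of_nonneg ht₀]

lemma lineBump_eq_zero {t : ℝ} (ht : 2 ≤ t) : lineBump t = 0 :=
  lineBump.zero_of_le_dist <| by
    rwa [dist_zero_right, Real.norm_of_nonneg (zero_le_two.trans ht)]

lemma annularCutoff_eq_one {k : ℕ} {x : E} (hx_lower : 2 / (k + 1 : ℝ) ≤ ‖x‖ ^ 2)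
    (hx_upper : ‖x‖ ^ 2 ≤ k + 1) : annularCutoff k x = 1 := by
  have hk : (0 : ℝ) < k + 1 := by positivity
  rw [annularCutoff, lineBump_eq_one (by positivity)
    (by rwa [inv_mul_le_iff₀ hk, mul_one]), lineBump_eq_zero (by rwa [mul_comm, ← div_le_iff₀ hk]),
    sub_zero]

lemma eventually_annularCutoff_eq_one {x : E} (hx : x ≠ 0) :
    ∀ᶠ k : ℕ in atTop, ∀ᶠ y in 𝓝 x, annularCutoff k y = 1 := by
  have hx_pos : 0 < ‖x‖ ^ 2 := by positivity
  have hnorm_sq : Tendsto (fun y : E => ‖y‖ ^ 2) (𝓝 x) (𝓝 (‖x‖ ^ 2)) :=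
    Continuous.tendsto (by fun_prop) x
  have hk_tendsto : Tendsto (fun k : ℕ => (k + 1 : ℝ)) atTop atTop :=
    tendsto_atTop_add_const_right _ _ tendsto_natCast_atTop_atTop
  filter_upwards [hk_tendsto.eventually_gt_atTop (‖x‖ ^ 2),
    (hk_tendsto.const_div_atTop 2).eventually_lt_const hx_pos] with k hk_upper hk_lower
  filter_upwards [hnorm_sq.eventually_const_lt hk_lower, hnorm_sq.eventually_lt_const hk_upper]
    with y hy_lower hy_upper
  exact annularCutoff_eq_one hy_lower.le hy_upper.le

lemma eventually_annularCutoff_smul_eventuallyEq [AddCommGroup F] [Module ℝ F] (h : E → F) {x : E}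
    (hx : x ≠ 0) : ∀ᶠ k : ℕ in atTop, (fun y => annularCutoff k y • h y) =ᶠ[𝓝 x] h := by
  filter_upwards [eventually_annularCutoff_eq_one hx] with k hk
  filter_upwards [hk] with y hy
  rw [hy, one_smul]

variable [InnerProductSpace ℝ E]

lemma contDiff_annularCutoff (k : ℕ) : ContDiff ℝ ∞ (annularCutoff k : E → ℝ) :=
  (lineBump.contDiff.comp (contDiff_const.mul (contDiff_norm_sq ℝ))).sub
    (lineBump.contDiff.comp (contDiff_const.mul (contDiff_norm_sq ℝ)))

lemma hasCompactSupport_lineBump_mul_norm_sq [FiniteDimensional ℝ E] {s : ℝ} (hs : 0 < s) :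
    HasCompactSupport fun x : E => lineBump (s * ‖x‖ ^ 2) := by
  refine HasCompactSupport.intro (isCompact_closedBall (0 : E) √(2 / s)) fun x hx => ?_
  rw [Metric.mem_closedBall, dist_zero_right, not_le] at hx
  refine lineBump_eq_zero ?_
  rw [mul_comm, ← div_le_iff₀ hs]
  exact (Real.lt_sq_of_sqrt_lt hx).le

lemma hasCompactSupport_annularCutoff [FiniteDimensional ℝ E] (k : ℕ) :
    HasCompactSupport (annularCutoff k : E → ℝ) :=
  (hasCompactSupport_lineBump_mul_norm_sq (by positivity)).sub
    (hasCompactSupport_lineBump_mul_norm_sq (by positivity))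

lemma exists_lipschitzWith_annularCutoff [FiniteDimensional ℝ E] (k : ℕ) :
    ∃ C, LipschitzWith C (annularCutoff k : E → ℝ) :=
  ((contDiff_annularCutoff k).of_le (by simp)).lipschitzWith_of_hasCompactSupport
    (hasCompactSupport_annularCutoff k) one_ne_zero

lemma hasFDerivAt_lineBump_mul_norm_sq (s : ℝ) (x : E) :
    HasFDerivAt (fun x : E => lineBump (s * ‖x‖ ^ 2))
      (deriv lineBump (s * ‖x‖ ^ 2) • s • (2 • innerSL ℝ x)) x :=
  (lineBump.contDiff.differentiable (n := 1) one_ne_zero _).hasDerivAt.comp_hasFDerivAt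
    (f := fun y : E => s * ‖y‖ ^ 2) x ((hasStrictFDerivAt_norm_sq x).hasFDerivAt.const_mul s)

lemma norm_mul_norm_fderiv_lineBump_mul_norm_sq (s : ℝ) (x : E) :
    ‖x‖ * ‖fderiv ℝ (fun x : E => lineBump (s * ‖x‖ ^ 2)) x‖ =
      2 * ‖s * ‖x‖ ^ 2 * deriv lineBump (s * ‖x‖ ^ 2)‖ := by
  rw [(hasFDerivAt_lineBump_mul_norm_sq s x).fderiv]
  simp only [norm_smul, norm_mul, norm_pow, norm_norm, ← Nat.cast_smul_eq_nsmul ℝ,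
    innerSL_apply_norm, Nat.cast_ofNat, Real.norm_ofNat]
  ring

variable (E) in
lemma exists_norm_fderiv_annularCutoff_le :
    ∃ B : ℝ, ∀ (k : ℕ) (x : E), x ≠ 0 → ‖fderiv ℝ (annularCutoff k) x‖ ≤ B / ‖x‖ := by
  have hcont : Continuous fun t : ℝ => t * deriv lineBump t :=
    continuous_id.mul (lineBump.contDiff.continuous_deriv (n := 1) le_rfl)
  obtain ⟨B, hB⟩ := hcont.bounded_above_of_compact_support
    lineBump.hasCompactSupport.deriv.mul_left
  refine ⟨2 * B + 2 * B, fun k x hx => ?_⟩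
  have hfderiv : fderiv ℝ (annularCutoff k) x =
      fderiv ℝ (fun x : E => lineBump ((k + 1 : ℝ)⁻¹ * ‖x‖ ^ 2)) x -
        fderiv ℝ (fun x : E => lineBump ((k + 1 : ℝ) * ‖x‖ ^ 2)) x :=
    fderiv_fun_sub (hasFDerivAt_lineBump_mul_norm_sq _ x).differentiableAt
      (hasFDerivAt_lineBump_mul_norm_sq _ x).differentiableAt
  have hscaled (s : ℝ) : ‖x‖ * ‖fderiv ℝ (fun x : E => lineBump (s * ‖x‖ ^ 2)) x‖ ≤ 2 * B := by
    rw [norm_mul_norm_fderiv_lineBump_mul_norm_sq]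
    gcongr
    exact hB _
  rw [hfderiv, le_div_iff₀' (norm_pos_iff.2 hx)]
  calc _ ≤ ‖x‖ * (_ + _) := by gcongr; exact norm_sub_le _ _
    _ ≤ 2 * B + 2 * B := by rw [mul_add]; exact add_le_add (hscaled _) (hscaled _)

end AnnularCutoff

section ScaleLipschitz

open scoped ContDiff Topology
open Filter

variable {E F : Type*} [NormedAddCommGroup E] [NormedAddCommGroup F]

/-- Bounded maps on `E \ {0}` whose Lipschitz constant at `x` is at most `K / ‖x‖`, such as the
functions that are constant along rays and Lipschitz on a sphere. -/
structure ScaleLipschitz (K M : ℝ) (h : E → F) : Prop where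
  norm_sub_le : ∀ x y, x ≠ 0 → y ≠ 0 → ‖h x - h y‖ ≤ K / ‖x‖ * ‖x - y‖
  norm_le : ∀ x, x ≠ 0 → ‖h x‖ ≤ M
  lip_nonneg : 0 ≤ K
  bound_nonneg : 0 ≤ M

namespace ScaleLipschitz

variable {K M : ℝ} {h : E → F}

lemma sub_const (hh : ScaleLipschitz K M h) (m : F) :
    ScaleLipschitz K (M + ‖m‖) fun x => h x - m where
  norm_sub_le x y hx hy := by simpa using hh.norm_sub_le x y hx hy
  norm_le x hx := (_root_.norm_sub_le _ _).trans (by gcongr; exact hh.norm_le x hx)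
  lip_nonneg := hh.lip_nonneg
  bound_nonneg := add_nonneg hh.bound_nonneg (norm_nonneg _)

lemma continuousAt (hh : ScaleLipschitz K M h) {x : E} (hx : x ≠ 0) : ContinuousAt h x := by
  refine tendsto_iff_norm_sub_tendsto_zero.2 (squeeze_zero' (.of_forall fun _ => norm_nonneg _)
    (g := fun y => K / ‖x‖ * ‖x - y‖) ?_ ?_)
  · filter_upwards [isOpen_ne.mem_nhds hx] with y hy
    rw [norm_sub_rev]
    exact hh.norm_sub_le x y hx hy
  · simpa using (Continuous.tendsto (by fun_prop) x :
      Tendsto (fun y => K / ‖x‖ * ‖x - y‖) (𝓝 x) (𝓝 (K / ‖x‖ * ‖x - x‖)))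

lemma aestronglyMeasurable [MeasurableSpace E] [BorelSpace E] [SecondCountableTopology E]
    (hh : ScaleLipschitz K M h) {μ : Measure E} (hμ : ∀ᵐ x ∂μ, x ≠ 0) :
    AEStronglyMeasurable h μ := by
  have hcont : ContinuousOn h {0}ᶜ := fun x hx => (hh.continuousAt hx).continuousWithinAt
  have hmeas := hcont.aestronglyMeasurable (μ := μ) (measurableSet_singleton 0).compl
  rwa [Measure.restrict_eq_self_of_ae_mem (by simpa using hμ)] at hmeas

variable [NormedSpace ℝ F]

lemma norm_smul_sub_smul_le (hh : ScaleLipschitz K M h) {c : E → ℝ} {C : NNReal}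
    (hc : LipschitzWith C c) (hc_zero : c 0 = 0) {x y : E} (hx : x ≠ 0) (hy : y ≠ 0) :
    ‖c x • h x - c y • h y‖ ≤ C * (K + M) * ‖x - y‖ := by
  have hcx : |c x| ≤ C * ‖x‖ := by simpa [hc_zero] using hc.norm_sub_le x 0
  calc ‖c x • h x - c y • h y‖ = ‖c x • (h x - h y) + (c x - c y) • h y‖ := by
        congr 1
        module
    _ ≤ |c x| * ‖h x - h y‖ + ‖c x - c y‖ * ‖h y‖ :=
        (norm_add_le _ _).trans_eq (by rw [norm_smul, norm_smul, Real.norm_eq_abs])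
    _ ≤ C * ‖x‖ * (K / ‖x‖ * ‖x - y‖) + C * ‖x - y‖ * M := by
        gcongr
        · exact hh.norm_sub_le x y hx hy
        · exact hc.norm_sub_le x y
        · exact hh.norm_le y hy
    _ = C * (K + M) * ‖x - y‖ := by field_simp

lemma lipschitzWith_smul (hh : ScaleLipschitz K M h) {c : E → ℝ} {C : NNReal}
    (hc : LipschitzWith C c) (hc_zero : c 0 = 0) :
    LipschitzWith (C * (K + M).toNNReal) fun x => c x • h x := by
  have hK := hh.lip_nonneg
  have hM := hh.bound_nonneg
  have hle (x) : ‖c x • h x‖ ≤ C * (K + M) * ‖x‖ := by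
    rcases eq_or_ne x 0 with rfl | hx
    · simp [hc_zero]
    calc ‖c x • h x‖ = |c x| * ‖h x‖ := norm_smul _ _
      _ ≤ C * ‖x‖ * (K + M) := by
          gcongr
          · simpa [hc_zero] using hc.norm_sub_le x 0
          · exact (hh.norm_le x hx).trans (le_add_of_nonneg_left hK)
      _ = C * (K + M) * ‖x‖ := by ring
  refine LipschitzWith.of_dist_le_mul fun x y => ?_
  rw [dist_eq_norm, dist_eq_norm, NNReal.coe_mul, Real.coe_toNNReal _ (add_nonneg hK hM)]
  rcases eq_or_ne x 0 with rfl | hx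
  · simpa [hc_zero] using hle y
  rcases eq_or_ne y 0 with rfl | hy
  · simpa [hc_zero] using hle x
  exact hh.norm_smul_sub_smul_le hc hc_zero hx hy

lemma norm_annularCutoff_smul_le (hh : ScaleLipschitz K M h) (k : ℕ) (x : E) :
    ‖annularCutoff k x • h x‖ ≤ M := by
  rcases eq_or_ne x 0 with rfl | hx
  · simpa [annularCutoff_zero] using hh.bound_nonneg
  · rw [norm_smul, Real.norm_eq_abs, ← one_mul M]
    exact mul_le_mul (abs_annularCutoff_le_one k x) (hh.norm_le x hx) (norm_nonneg _) zero_le_one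

variable [InnerProductSpace ℝ E]

lemma norm_fderiv_le (hh : ScaleLipschitz K M h) {x : E} (hx : x ≠ 0) :
    ‖fderiv ℝ h x‖ ≤ K / ‖x‖ := by
  refine norm_fderiv_le_of_lip' ℝ (div_nonneg hh.lip_nonneg (norm_nonneg _)) ?_
  filter_upwards [isOpen_ne.mem_nhds hx] with y hy
  rw [norm_sub_rev, norm_sub_rev y]
  exact hh.norm_sub_le x y hx hy

lemma norm_fderiv_annularCutoff_smul_le (hh : ScaleLipschitz K M h) {B : ℝ} {k : ℕ} {x : E}
    (hB : ‖fderiv ℝ (annularCutoff k) x‖ ≤ B / ‖x‖) (hx : x ≠ 0) (hdiff : DifferentiableAt ℝ h x) :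
    ‖fderiv ℝ (fun x => annularCutoff k x • h x) x‖ ≤ (K + B * M) / ‖x‖ := by
  have hcutoff : DifferentiableAt ℝ (annularCutoff k) x :=
    (contDiff_annularCutoff k).differentiable (by simp) x
  calc _ ≤ |annularCutoff k x| * ‖fderiv ℝ h x‖ + ‖fderiv ℝ (annularCutoff k) x‖ * ‖h x‖ := by
        rw [fderiv_fun_smul hcutoff hdiff]
        refine (norm_add_le _ _).trans_eq ?_
        rw [norm_smul, ContinuousLinearMap.norm_smulRight_apply, Real.norm_eq_abs]
    _ ≤ 1 * (K / ‖x‖) + B / ‖x‖ * M := by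
        gcongr
        · exact abs_annularCutoff_le_one k x
        · exact hh.norm_fderiv_le hx
        · exact (norm_nonneg _).trans hB
        · exact hh.norm_le x hx
    _ = (K + B * M) / ‖x‖ := by ring

variable [FiniteDimensional ℝ E]

lemma exists_lipschitzWith_annularCutoff_smul (hh : ScaleLipschitz K M h) (k : ℕ) :
    ∃ C, LipschitzWith C fun x => annularCutoff k x • h x := by
  obtain ⟨C, hC⟩ := exists_lipschitzWith_annularCutoff (E := E) k
  exact ⟨_, hh.lipschitzWith_smul hC (annularCutoff_zero k)⟩

lemma ae_differentiableAt [MeasurableSpace E] [BorelSpace E] [Nontrivial E] [FiniteDimensional ℝ F]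
    (hh : ScaleLipschitz K M h) : ∀ᵐ x, DifferentiableAt ℝ h x := by
  have hcutoff : ∀ᵐ x : E, ∀ k : ℕ, DifferentiableAt ℝ (fun y => annularCutoff k y • h y) x :=
    ae_all_iff.2 fun k => by
      obtain ⟨C, hC⟩ := hh.exists_lipschitzWith_annularCutoff_smul k
      exact hC.ae_differentiableAt
  filter_upwards [hcutoff, Measure.ae_ne volume (0 : E)] with x hx hx_ne
  obtain ⟨k, hk⟩ := (eventually_annularCutoff_smul_eventuallyEq h hx_ne).exists
  exact (hx k).congr_of_eventuallyEq hk.symm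

end ScaleLipschitz

end ScaleLipschitz

section Polar

open Set Metric

variable {E : Type*} [NormedAddCommGroup E] [NormedSpace ℝ E]

/-- The radial projection `x ↦ R x / ‖x‖` onto the sphere of radius `R`. -/
noncomputable def sphereProj (R : ℝ) (x : E) : E := (R / ‖x‖) • x

lemma sphereProj_smul (R : ℝ) {t : ℝ} (ht : 0 < t) (x : E) :
    sphereProj R (t • x) = sphereProj R x := by
  rw [sphereProj, sphereProj, norm_smul, Real.norm_of_nonneg ht.le, smul_smul, div_mul_eq_mul_div,
    mul_comm R, mul_div_mul_left _ _ ht.ne']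

lemma norm_sphereProj {R : ℝ} (hR : 0 ≤ R) {x : E} (hx : x ≠ 0) : ‖sphereProj R x‖ = R := by
  rw [sphereProj, norm_smul, Real.norm_of_nonneg (by positivity),
    div_mul_cancel₀ _ (norm_ne_zero_iff.2 hx)]

lemma sphereProj_of_norm_eq {R : ℝ} (hR : R ≠ 0) {x : E} (hx : ‖x‖ = R) : sphereProj R x = x := by
  rw [sphereProj, hx, div_self hR, one_smul]

variable [SecondCountableTopology E] [MeasurableSpace E] [BorelSpace E]

@[fun_prop]
lemma measurable_sphereProj (R : ℝ) : Measurable (sphereProj R : E → E) := by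
  unfold sphereProj
  fun_prop

end Polar

section GaussianPolar

open Set Metric

variable {E : Type*} [NormedAddCommGroup E] [InnerProductSpace ℝ E] [FiniteDimensional ℝ E]
  [MeasurableSpace E] [BorelSpace E]

variable (E) in
/-- The uniform distribution on the sphere of radius `R`, encoded as the law of the radial
projection of a standard Gaussian vector. -/
noncomputable def sphereLaw (R : ℝ) : Measure E := (stdGaussian E).map (sphereProj R)

instance (R : ℝ) : IsProbabilityMeasure (sphereLaw E R) :=
  Measure.isProbabilityMeasure_map (measurable_sphereProj R).aemeasurable

lemma integral_sphereLaw {F : Type*} [NormedAddCommGroup F] [NormedSpace ℝ F] {R : ℝ} {G : E → F}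
    (hG : AEStronglyMeasurable G (sphereLaw E R)) :
    ∫ x, G x ∂sphereLaw E R = ∫ x, G (sphereProj R x) ∂stdGaussian E :=
  integral_map (measurable_sphereProj R).aemeasurable hG

variable [Nontrivial E]

lemma ae_norm_eq_sphereLaw {R : ℝ} (hR : 0 ≤ R) : ∀ᵐ x ∂sphereLaw E R, ‖x‖ = R := by
  refine (ae_map_iff (measurable_sphereProj R).aemeasurable
    (measurableSet_eq_fun measurable_norm measurable_const)).2 ?_
  exact ae_ne_zero_stdGaussian.mono fun x => norm_sphereProj hR

lemma lintegral_polar (f : E → ENNReal) :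
    ∫⁻ x, f x = ∫⁻ p : sphere (0 : E) 1 × Ioi (0 : ℝ), f (p.2.1 • p.1.1)
      ∂(volume : Measure E).toSphere.prod (.volumeIoiPow (Module.finrank ℝ E - 1)) := by
  have hpolar := (volume : Measure E).measurePreserving_homeomorphUnitSphereProd.lintegral_comp_emb
    (homeomorphUnitSphereProd E).measurableEmbedding fun p => f (p.2.1 • p.1.1)
  have hinv (x : ({0}ᶜ : Set E)) : ‖x.1‖ • ‖x.1‖⁻¹ • x.1 = x.1 :=
    smul_inv_smul₀ (norm_ne_zero_iff.2 x.2) _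
  simp only [homeomorphUnitSphereProd_apply_snd_coe, homeomorphUnitSphereProd_apply_fst_coe,
    hinv] at hpolar
  rw [← hpolar, lintegral_subtype_comap (measurableSet_singleton _).compl f,
    restrict_compl_singleton]

lemma stdGaussian_preimage_norm_inter_preimage_sphereProj (R : ℝ) {A : Set ℝ} {B : Set E}
    (hA : MeasurableSet A) (hB : MeasurableSet B) :
    stdGaussian E (norm ⁻¹' A ∩ sphereProj R ⁻¹' B) =
      (∫⁻ s, B.indicator 1 (R • s.1) ∂(volume : Measure E).toSphere) *
        ∫⁻ r, A.indicator (fun r => .ofReal ((gaussMass E)⁻¹ * Real.exp (-(1 / 2) * r ^ 2))) r.1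
          ∂.volumeIoiPow (Module.finrank ℝ E - 1) := by
  rw [stdGaussian_eq_withDensity, withDensity_apply _ ((measurable_norm hA).inter
    (measurable_sphereProj R hB)), ← lintegral_indicator ((measurable_norm hA).inter
    (measurable_sphereProj R hB)), lintegral_polar, ← lintegral_prod_mul]
  · refine lintegral_congr fun p => ?_
    have hnorm : ‖p.2.1 • p.1.1‖ = p.2.1 := by
      rw [norm_smul, norm_eq_of_mem_sphere, mul_one, Real.norm_of_nonneg p.2.2.le]
    have hproj : sphereProj R (p.2.1 • p.1.1) = R • p.1.1 := by
      rw [sphereProj_smul R p.2.2, sphereProj, norm_eq_of_mem_sphere, div_one]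
    simp only [indicator, mem_inter_iff, mem_preimage, hnorm, hproj, gaussDensity]
    split_ifs <;> simp_all
  · exact ((measurable_one.indicator hB).comp
      (measurable_subtype_coe.const_smul R)).aemeasurable
  · exact ((Measurable.indicator (by fun_prop) hA).comp measurable_subtype_coe).aemeasurable

theorem indepFun_norm_sphereProj (R : ℝ) : IndepFun norm (sphereProj R) (stdGaussian E) := by
  refine indepFun_iff_measure_inter_preimage_eq_mul.2 fun A B hA hB => ?_
  have hfactor {A : Set ℝ} {B : Set E} (hA : MeasurableSet A) (hB : MeasurableSet B) :=
    stdGaussian_preimage_norm_inter_preimage_sphereProj R hA hB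
  have hA_univ := hfactor hA .univ
  have hB_univ := hfactor .univ hB
  have huniv := hfactor .univ .univ
  simp only [preimage_univ, inter_univ, univ_inter, measure_univ] at hA_univ hB_univ huniv
  rw [hfactor hA hB, hA_univ, hB_univ, mul_comm (lintegral _ fun s => B.indicator 1 _),
    mul_comm (lintegral _ fun s => B.indicator 1 _), mul_mul_mul_comm, mul_comm (lintegral _ _),
    ← mul_assoc, mul_right_comm, ← huniv, one_mul, mul_comm]

variable {R : ℝ} {q : ℝ → ℝ} {G : E → ℝ}

lemma integral_norm_mul_sphereProj (hq : Measurable q)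
    (hG : AEStronglyMeasurable G (sphereLaw E R)) :
    ∫ x, q ‖x‖ * G (sphereProj R x) ∂stdGaussian E =
      (∫ x, q ‖x‖ ∂stdGaussian E) * ∫ x, G x ∂sphereLaw E R := by
  rw [integral_sphereLaw hG]
  exact (indepFun_norm_sphereProj R).integral_fun_comp_mul_comp measurable_norm.aemeasurable
    (measurable_sphereProj R).aemeasurable hq.aestronglyMeasurable hG

lemma integrable_norm_mul_sphereProj (hq : Measurable q)
    (hq_int : Integrable (fun x : E => q ‖x‖) (stdGaussian E))
    (hG : Integrable G (sphereLaw E R)) :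
    Integrable (fun x => q ‖x‖ * G (sphereProj R x)) (stdGaussian E) :=
  ((indepFun_norm_sphereProj R).comp₀ measurable_norm.aemeasurable
    (measurable_sphereProj R).aemeasurable hq.aemeasurable hG.aemeasurable).integrable_mul
    hq_int (hG.comp_measurable (measurable_sphereProj R))

lemma integral_norm_rpow_mul_exp {p : ℝ} (hp : -Module.finrank ℝ E < p) :
    ∫ x : E, ‖x‖ ^ p * Real.exp (-(1 / 2) * ‖x‖ ^ 2) =
      Module.finrank ℝ E * (volume : Measure E).real (ball 0 1) *
        ((1 / 2) ^ (-(Module.finrank ℝ E + p) / 2) * (1 / 2) *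
          Real.Gamma ((Module.finrank ℝ E + p) / 2)) := by
  have hpow : ∀ r ∈ Ioi (0 : ℝ), r ^ (Module.finrank ℝ E - 1) •
      (r ^ p * Real.exp (-(1 / 2) * r ^ 2)) =
        r ^ (Module.finrank ℝ E + p - 1) * Real.exp (-(1 / 2) * r ^ (2 : ℝ)) := fun r hr => by
    rw [smul_eq_mul, ← mul_assoc, ← Real.rpow_natCast, ← Real.rpow_add hr,
      Nat.cast_pred Module.finrank_pos, Real.rpow_two]
    ring_nf
  rw [integral_fun_norm_addHaar volume fun r : ℝ => r ^ p * Real.exp (-(1 / 2) * r ^ 2),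
    setIntegral_congr_fun measurableSet_Ioi hpow, integral_rpow_mul_exp_neg_mul_rpow two_pos
      (by linarith) one_half_pos, sub_add_cancel, nsmul_eq_mul, smul_eq_mul,
    mul_assoc (Module.finrank ℝ E : ℝ)]

lemma integral_norm_rpow_stdGaussian {p : ℝ} (hp : -Module.finrank ℝ E < p) :
    ∫ x : E, ‖x‖ ^ p ∂stdGaussian E =
      2 ^ (p / 2) * Real.Gamma ((Module.finrank ℝ E + p) / 2) /
        Real.Gamma (Module.finrank ℝ E / 2) := by
  have hdim : (0 : ℝ) < Module.finrank ℝ E := mod_cast Module.finrank_pos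
  have hball : 0 < (volume : Measure E).real (ball 0 1) :=
    ENNReal.toReal_pos (measure_ball_pos _ _ one_pos).ne' measure_ball_lt_top.ne
  have hGamma : Real.Gamma (Module.finrank ℝ E / 2) ≠ 0 :=
    (Real.Gamma_pos_of_pos (half_pos hdim)).ne'
  have hmass : gaussMass E = Module.finrank ℝ E * (volume : Measure E).real (ball 0 1) *
      ((1 / 2) ^ (-(Module.finrank ℝ E : ℝ) / 2) * (1 / 2) *
        Real.Gamma (Module.finrank ℝ E / 2)) := by
    simpa [gaussMass] using integral_norm_rpow_mul_exp (E := E) (p := 0) (by simpa using hdim)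
  have hsplit : (1 / 2 : ℝ) ^ (-(Module.finrank ℝ E + p) / 2) =
      (1 / 2) ^ (-(Module.finrank ℝ E : ℝ) / 2) * 2 ^ (p / 2) := by
    rw [neg_add, add_div, Real.rpow_add one_half_pos, neg_div _ p, Real.rpow_neg one_half_pos.le,
      one_div, Real.inv_rpow zero_le_two (p / 2), inv_inv]
  simp only [integral_stdGaussian, gaussDensity, smul_eq_mul, mul_assoc, integral_const_mul]
  simp only [mul_comm (Real.exp _), integral_norm_rpow_mul_exp hp, hmass, hsplit]
  field_simp

lemma integrable_norm_rpow_stdGaussian {p : ℝ} (hp : -Module.finrank ℝ E < p) :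
    Integrable (fun x : E => ‖x‖ ^ p) (stdGaussian E) := by
  refine Integrable.of_integral_ne_zero ?_
  rw [integral_norm_rpow_stdGaussian hp]
  have hsum : 0 < Module.finrank ℝ E + p := by linarith
  have hdim : (0 : ℝ) < Module.finrank ℝ E := mod_cast Module.finrank_pos
  have := Real.Gamma_pos_of_pos (half_pos hsum)
  have := Real.Gamma_pos_of_pos (half_pos hdim)
  positivity

end GaussianPolar

section InverseSquare

variable {E : Type*} [NormedAddCommGroup E] [InnerProductSpace ℝ E] [FiniteDimensional ℝ E]
  [MeasurableSpace E] [BorelSpace E]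

lemma integrable_inv_norm_sq_stdGaussian (hE : 3 ≤ Module.finrank ℝ E) :
    Integrable (fun x : E => (‖x‖ ^ 2)⁻¹) (stdGaussian E) := by
  have : Nontrivial E := Module.nontrivial_of_finrank_pos (R := ℝ) (by lia)
  have hdim : (3 : ℝ) ≤ Module.finrank ℝ E := mod_cast hE
  simpa only [Real.rpow_neg_ofNat, zpow_neg, zpow_ofNat] using
    integrable_norm_rpow_stdGaussian (E := E) (p := -2) (by linarith)

lemma integral_inv_norm_sq_stdGaussian (hE : 3 ≤ Module.finrank ℝ E) :
    ∫ x : E, (‖x‖ ^ 2)⁻¹ ∂stdGaussian E = ((Module.finrank ℝ E : ℝ) - 2)⁻¹ := by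
  have : Nontrivial E := Module.nontrivial_of_finrank_pos (R := ℝ) (by lia)
  have hdim : (3 : ℝ) ≤ Module.finrank ℝ E := mod_cast hE
  have hmoment := integral_norm_rpow_stdGaussian (E := E) (p := -2) (by linarith)
  have hne : ((Module.finrank ℝ E : ℝ) + -2) / 2 ≠ 0 := by linarith
  have hGamma := Real.Gamma_add_one hne
  have hpos := Real.Gamma_pos_of_pos (show 0 < ((Module.finrank ℝ E : ℝ) + -2) / 2 by linarith)
  rw [show ((Module.finrank ℝ E : ℝ) + -2) / 2 + 1 = Module.finrank ℝ E / 2 by ring] at hGamma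
  simp only [Real.rpow_neg_ofNat, zpow_neg, zpow_ofNat, hGamma] at hmoment
  rw [hmoment, neg_div, div_self two_ne_zero, Real.rpow_neg_one]
  field_simp
  ring

end InverseSquare

section GaussianScaleLipschitz

open Filter

variable {E : Type*} [NormedAddCommGroup E] [InnerProductSpace ℝ E] [FiniteDimensional ℝ E]
  [MeasurableSpace E] [BorelSpace E]

theorem ScaleLipschitz.steinPoincare (hE : 3 ≤ Module.finrank ℝ E) {K M : ℝ} {h : E → E}
    (hh : ScaleLipschitz K M h) : SteinPoincare h (fderiv ℝ h) := by
  have : Nontrivial E := Module.nontrivial_of_finrank_pos (R := ℝ) (by lia)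
  obtain ⟨B, hB⟩ := exists_norm_fderiv_annularCutoff_le E
  have hne : ∀ᵐ x ∂stdGaussian E, x ≠ 0 := ae_ne_zero_stdGaussian
  refine SteinPoincare.of_tendsto (M := M) (w := fun x => (K + B * M) / ‖x‖)
    (G := fun k x => annularCutoff k x • h x)
    (G' := fun k => fderiv ℝ fun x => annularCutoff k x • h x) (fun k => ?_) (fun k => ?_)
    (fun k => (measurable_fderiv ℝ _).aestronglyMeasurable)
    (fun k => .of_forall fun x => hh.norm_annularCutoff_smul_le k x)
    (fun k => ?_) ?_ ?_ ?_
  · obtain ⟨C, hC⟩ := hh.exists_lipschitzWith_annularCutoff_smul k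
    exact .of_lipschitzWith hC (hasCompactSupport_annularCutoff k).smul_right
  · obtain ⟨C, hC⟩ := hh.exists_lipschitzWith_annularCutoff_smul k
    exact hC.continuous.aestronglyMeasurable
  · filter_upwards [hne, stdGaussian_absolutelyContinuous.ae_le hh.ae_differentiableAt]
      with x hx hx_diff
    exact hh.norm_fderiv_annularCutoff_smul_le (hB k x hx) hx hx_diff
  · simp_rw [div_pow, div_eq_mul_inv]
    exact (integrable_inv_norm_sq_stdGaussian hE).const_mul _
  · filter_upwards [hne] with x hx
    exact tendsto_const_nhds.congr' <| (eventually_annularCutoff_smul_eventuallyEq h hx).mono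
      fun k hk => hk.eq_of_nhds.symm
  · filter_upwards [hne] with x hx
    exact tendsto_const_nhds.congr' <| (eventually_annularCutoff_smul_eventuallyEq h hx).mono
      fun k hk => hk.fderiv_eq.symm

end GaussianScaleLipschitz

section SphereFDeriv

open scoped Topology
open Filter Metric

lemma norm_inv_smul_sub_inv_smul_le {E : Type*} [NormedAddCommGroup E] [NormedSpace ℝ E] {x y : E}
    (hx : x ≠ 0) (hy : y ≠ 0) : ‖‖x‖⁻¹ • x - ‖y‖⁻¹ • y‖ ≤ 2 / ‖x‖ * ‖x - y‖ := by
  have hx_pos : 0 < ‖x‖ := norm_pos_iff.2 hx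
  have hy_pos : 0 < ‖y‖ := norm_pos_iff.2 hy
  calc ‖‖x‖⁻¹ • x - ‖y‖⁻¹ • y‖ = ‖‖x‖⁻¹ • (x - y) + (‖x‖⁻¹ - ‖y‖⁻¹) • y‖ := by
        congr 1
        module
    _ ≤ ‖x‖⁻¹ * ‖x - y‖ + |‖x‖⁻¹ - ‖y‖⁻¹| * ‖y‖ :=
        (norm_add_le _ _).trans_eq (by simp only [norm_smul, norm_inv, Real.norm_eq_abs, abs_norm])
    _ = ‖x‖⁻¹ * ‖x - y‖ + ‖x‖⁻¹ * |‖y‖ - ‖x‖| := by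
        rw [inv_sub_inv hx_pos.ne' hy_pos.ne', abs_div, abs_of_pos (mul_pos hx_pos hy_pos)]
        field_simp
    _ ≤ ‖x‖⁻¹ * ‖x - y‖ + ‖x‖⁻¹ * ‖x - y‖ := by
        gcongr
        exact (abs_norm_sub_norm_le y x).trans_eq (norm_sub_rev y x)
    _ = 2 / ‖x‖ * ‖x - y‖ := by ring

lemma scaleLipschitz_inv_norm_smul {E : Type*} [NormedAddCommGroup E] [NormedSpace ℝ E] :
    ScaleLipschitz 2 1 fun y : E => ‖y‖⁻¹ • y where
  norm_sub_le _ _ hx hy := norm_inv_smul_sub_inv_smul_le hx hy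
  norm_le _ hx := (norm_smul_inv_norm (𝕜 := ℝ) hx).le
  lip_nonneg := zero_le_two
  bound_nonneg := zero_le_one

lemma differentiableAt_inv_norm_smul {E : Type*} [NormedAddCommGroup E] [InnerProductSpace ℝ E]
    {y : E} (hy : y ≠ 0) : DifferentiableAt ℝ (fun y : E => ‖y‖⁻¹ • y) y :=
  ((differentiableAt_id.norm ℝ hy).inv (norm_ne_zero_iff.2 hy)).smul differentiableAt_id

lemma eventuallyEq_comp_sphereProj {E F : Type*} [NormedAddCommGroup E] [NormedSpace ℝ E] {R : ℝ}
    {f g : E → F} {x : E} (hR : 0 ≤ R) (hx : x ≠ 0)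
    (hfg : f =ᶠ[𝓝[sphere 0 R] (sphereProj R x)] g) :
    f ∘ sphereProj R =ᶠ[𝓝 x] g ∘ sphereProj R := by
  have hproj : ContinuousAt (sphereProj R) x :=
    (continuousAt_const.div continuousAt_id.norm (norm_ne_zero_iff.2 hx)).smul continuousAt_id
  refine (tendsto_nhdsWithin_iff.2 ⟨hproj, ?_⟩).eventually hfg
  filter_upwards [isOpen_ne.mem_nhds hx] with y hy
  simpa using norm_sphereProj hR hy

variable {E F : Type*} [NormedAddCommGroup E] [NormedSpace ℝ E] [NormedAddCommGroup F] {R : ℝ}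
  {f g : E → F} {x : E}

lemma scaleLipschitz_comp_sphereProj {C : NNReal} {M : ℝ} (hR : 0 ≤ R) (hM : 0 ≤ M)
    (hf : LipschitzOnWith C f (sphere 0 R)) (hf_le : ∀ x ∈ sphere (0 : E) R, ‖f x‖ ≤ M) :
    ScaleLipschitz (C * (R * 2)) M (f ∘ sphereProj R) where
  norm_sub_le x y hx hy := by
    calc ‖f (sphereProj R x) - f (sphereProj R y)‖ ≤ C * ‖sphereProj R x - sphereProj R y‖ :=
          hf.norm_sub_le (by simpa using norm_sphereProj hR hx)
            (by simpa using norm_sphereProj hR hy)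
      _ = C * (R * ‖‖x‖⁻¹ • x - ‖y‖⁻¹ • y‖) := by
          rw [sphereProj, sphereProj, div_eq_mul_inv, div_eq_mul_inv, mul_smul, mul_smul,
            ← smul_sub, norm_smul, Real.norm_of_nonneg hR]
      _ ≤ C * (R * (2 / ‖x‖ * ‖x - y‖)) := by
          gcongr
          exact norm_inv_smul_sub_inv_smul_le hx hy
      _ = C * (R * 2) / ‖x‖ * ‖x - y‖ := by ring
  norm_le x hx := hf_le _ (by simpa using norm_sphereProj hR hx)
  lip_nonneg := by positivity
  bound_nonneg := hM

lemma exists_scaleLipschitz_comp_sphereProj [ProperSpace E] (hR : 0 ≤ R)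
    (hf : LocallyLipschitzOn (sphere 0 R) f) : ∃ K M, ScaleLipschitz K M (f ∘ sphereProj R) := by
  obtain ⟨C, hC⟩ := hf.exists_lipschitzOnWith_of_compact (isCompact_sphere _ _)
  obtain ⟨M, hM⟩ := (isCompact_sphere (0 : E) R).exists_bound_of_continuousOn hC.continuousOn
  exact ⟨_, _, scaleLipschitz_comp_sphereProj hR (abs_nonneg M) hC
    fun x hx => (hM x hx).trans (le_abs_self M)⟩

variable [NormedSpace ℝ F]

variable (R f) in
/-- The derivative of a map `f` defined on the sphere of radius `R`: the Fréchet derivative of the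
extension of `f` that is constant along rays. -/
noncomputable def sphereFDeriv (x : E) : E →L[ℝ] F := fderiv ℝ (f ∘ sphereProj R) x

lemma sphereFDeriv_smul {t : ℝ} (ht : 0 < t) (x : E) :
    t • sphereFDeriv R f (t • x) = sphereFDeriv R f x := by
  rw [sphereFDeriv, ← fderiv_comp_smul, sphereFDeriv]
  congr 1
  exact funext fun y => congrArg f (sphereProj_smul R ht y)

lemma sphereFDeriv_eq_smul (hR : 0 < R) (hx : x ≠ 0) :
    sphereFDeriv R f x = (R / ‖x‖) • sphereFDeriv R f (sphereProj R x) :=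
  (sphereFDeriv_smul (div_pos hR (norm_pos_iff.2 hx)) x).symm

lemma differentiableAt_comp_sphereProj_of_smul {t : ℝ} (ht : 0 < t)
    (hx : DifferentiableAt ℝ (f ∘ sphereProj R) (t • x)) :
    DifferentiableAt ℝ (f ∘ sphereProj R) x := by
  have hcomp : f ∘ sphereProj R = (f ∘ sphereProj R) ∘ fun y => t • y :=
    funext fun y => (congrArg f (sphereProj_smul R ht y)).symm
  rw [hcomp]
  exact hx.comp x (differentiableAt_id.const_smul t)

lemma differentiableAt_comp_sphereProj_sphereProj_iff (hR : 0 < R) (hx : x ≠ 0) :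
    DifferentiableAt ℝ (f ∘ sphereProj R) (sphereProj R x) ↔
      DifferentiableAt ℝ (f ∘ sphereProj R) x := by
  have hscale : 0 < R / ‖x‖ := div_pos hR (norm_pos_iff.2 hx)
  refine ⟨differentiableAt_comp_sphereProj_of_smul hscale, fun h =>
    differentiableAt_comp_sphereProj_of_smul (inv_pos.2 hscale) ?_⟩
  rwa [sphereProj, inv_smul_smul₀ hscale.ne']

lemma sphereFDeriv_comp {G : Type*} [NormedAddCommGroup G] [NormedSpace ℝ G] {φ : F → G}
    (hφ : DifferentiableAt ℝ φ (f (sphereProj R x)))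
    (hf : DifferentiableAt ℝ (f ∘ sphereProj R) x) :
    sphereFDeriv R (φ ∘ f) x = (fderiv ℝ φ (f (sphereProj R x))).comp (sphereFDeriv R f x) :=
  fderiv_comp x hφ hf

lemma sphereFDeriv_self (R : ℝ) (f : E → F) (x : E) : sphereFDeriv R f x x = 0 := by
  by_cases hdiff : DifferentiableAt ℝ (f ∘ sphereProj R) x
  · have hconst : (fun t : ℝ => f (sphereProj R (x + t • x))) =ᶠ[𝓝 0]
        fun _ => f (sphereProj R x) := by
      filter_upwards [lt_mem_nhds (neg_one_lt_zero (R := ℝ))] with t ht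
      rw [show x + t • x = (1 + t) • x by module, sphereProj_smul R (by linarith)]
    rw [sphereFDeriv, ← hdiff.lineDeriv_eq_fderiv, lineDeriv]
    exact hconst.deriv_eq.trans (deriv_const _ _)
  · rw [sphereFDeriv, fderiv_zero_of_not_differentiableAt hdiff, zero_apply]

end SphereFDeriv

section SphereLaw

variable {E : Type*} [NormedAddCommGroup E] [InnerProductSpace ℝ E] [FiniteDimensional ℝ E]
  [MeasurableSpace E] [BorelSpace E] {R : ℝ} {f : E → E}

omit [MeasurableSpace E] [BorelSpace E] in
lemma hsSq_sphereFDeriv (hR : 0 < R) {x : E} (hx : x ≠ 0) :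
    hsSq (sphereFDeriv R f x) = R ^ 2 * (‖x‖ ^ 2)⁻¹ * hsSq (sphereFDeriv R f (sphereProj R x)) := by
  rw [sphereFDeriv_eq_smul hR hx, hsSq_smul, div_pow, div_eq_mul_inv]

lemma ae_of_ae_sphereLaw {p : E → Prop} (hp : ∀ᵐ x ∂sphereLaw E R, p x) :
    ∀ᵐ x ∂stdGaussian E, p (sphereProj R x) :=
  ae_of_ae_map (measurable_sphereProj R).aemeasurable hp

@[fun_prop]
lemma measurable_sphereFDeriv : Measurable (sphereFDeriv R f) :=
  measurable_fderiv ℝ _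

lemma measurable_hsSq_sphereFDeriv : Measurable fun x => hsSq (sphereFDeriv R f x) :=
  continuous_hsSq.measurable.comp measurable_sphereFDeriv

variable [Nontrivial E]

lemma ae_ne_zero_sphereLaw (hR : 0 < R) : ∀ᵐ x ∂sphereLaw E R, x ≠ 0 :=
  (ae_norm_eq_sphereLaw hR.le).mono fun _ hx => norm_pos_iff.1 (hx ▸ hR)

lemma ae_sphereProj_eq_self (hR : 0 < R) : ∀ᵐ x ∂sphereLaw E R, sphereProj R x = x :=
  (ae_norm_eq_sphereLaw hR.le).mono fun _ => sphereProj_of_norm_eq hR.ne'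

lemma ae_differentiableAt_comp_sphereProj_iff (hR : 0 < R) :
    (∀ᵐ x ∂sphereLaw E R, DifferentiableAt ℝ (f ∘ sphereProj R) x) ↔
      ∀ᵐ x ∂stdGaussian E, DifferentiableAt ℝ (f ∘ sphereProj R) x := by
  rw [sphereLaw, ae_map_iff (measurable_sphereProj R).aemeasurable
    (measurableSet_of_differentiableAt ℝ _)]
  exact Filter.eventually_congr <| ae_ne_zero_stdGaussian.mono fun x =>
    differentiableAt_comp_sphereProj_sphereProj_iff hR

lemma integrable_mul_hsSq_sphereFDeriv (hE : 3 ≤ Module.finrank ℝ E) (hR : 0 < R) {a : E → ℝ}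
    (h_int : Integrable (fun x => a x * hsSq (sphereFDeriv R f x)) (sphereLaw E R)) :
    Integrable (fun x => a (sphereProj R x) * hsSq (sphereFDeriv R f x)) (stdGaussian E) := by
  refine (integrable_norm_mul_sphereProj (q := fun r => R ^ 2 * (r ^ 2)⁻¹) (by fun_prop)
    ((integrable_inv_norm_sq_stdGaussian hE).const_mul _) h_int).congr ?_
  filter_upwards [ae_ne_zero_stdGaussian] with x hx
  rw [hsSq_sphereFDeriv hR hx]
  ring

end SphereLaw

section RadiallyRegular

open scoped Topology
open Filter Metric

variable {E : Type*} [NormedAddCommGroup E] [InnerProductSpace ℝ E] [FiniteDimensional ℝ E]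
  [MeasurableSpace E] [BorelSpace E] {R : ℝ} {f g : E → E}

/-- Bounded maps on the sphere of radius `R` that are almost everywhere differentiable with square
integrable derivative, and whose radially constant extension satisfies, after subtraction of any
constant, the Gaussian inequalities of `SteinPoincare`. -/
structure RadiallyRegular (R : ℝ) (f : E → E) : Prop where
  aestronglyMeasurable : AEStronglyMeasurable f (sphereLaw E R)
  bounded : ∃ M, ∀ᵐ x ∂sphereLaw E R, ‖f x‖ ≤ M
  differentiable : ∀ᵐ x ∂sphereLaw E R, DifferentiableAt ℝ (f ∘ sphereProj R) x
  integrable : Integrable (fun x => hsSq (sphereFDeriv R f x)) (sphereLaw E R)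
  steinPoincare : ∀ m, SteinPoincare (fun x => f (sphereProj R x) - m) (sphereFDeriv R f)

namespace RadiallyRegular

lemma congr (hf : RadiallyRegular R f) (hR : 0 < R) [Nontrivial E]
    (hfg : ∀ᵐ x ∂sphereLaw E R, f =ᶠ[𝓝[sphere 0 R] x] g) : RadiallyRegular R g := by
  have hval : f =ᵐ[sphereLaw E R] g := by
    filter_upwards [hfg, ae_norm_eq_sphereLaw hR.le] with x hx hx_norm
    exact hx.eq_of_nhdsWithin (mem_sphere_zero_iff_norm.2 hx_norm)
  have hgauss : ∀ᵐ x ∂stdGaussian E, f ∘ sphereProj R =ᶠ[𝓝 x] g ∘ sphereProj R := by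
    filter_upwards [ae_of_ae_sphereLaw hfg, ae_ne_zero_stdGaussian] with x hx hx_ne
    exact eventuallyEq_comp_sphereProj hR.le hx_ne hx
  have hsphere : ∀ᵐ x ∂sphereLaw E R, f ∘ sphereProj R =ᶠ[𝓝 x] g ∘ sphereProj R := by
    filter_upwards [hfg, ae_ne_zero_sphereLaw hR, ae_sphereProj_eq_self hR] with x hx hx_ne hx_proj
    exact eventuallyEq_comp_sphereProj hR.le hx_ne (by rwa [hx_proj])
  refine ⟨hf.aestronglyMeasurable.congr hval, ?_, ?_, ?_, fun m => ?_⟩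
  · obtain ⟨M, hM⟩ := hf.bounded
    exact ⟨M, by filter_upwards [hM, hval] with x hx hx_eq using hx_eq ▸ hx⟩
  · filter_upwards [hf.differentiable, hsphere] with x hx hx_eq
    exact hx.congr_of_eventuallyEq hx_eq.symm
  · exact hf.integrable.congr (hsphere.mono fun x hx => congrArg hsSq hx.fderiv_eq)
  · exact (hf.steinPoincare m).congr_ae (hgauss.mono fun x hx => congrArg (· - m) hx.eq_of_nhds)
      (hgauss.mono fun x hx => hx.fderiv_eq)

theorem of_locallyLipschitzOn (hE : 3 ≤ Module.finrank ℝ E) (hR : 0 < R)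
    (hf : LocallyLipschitzOn (sphere 0 R) f) : RadiallyRegular R f := by
  have : Nontrivial E := Module.nontrivial_of_finrank_pos (R := ℝ) (by lia)
  obtain ⟨K, M, hh⟩ := exists_scaleLipschitz_comp_sphereProj hR.le hf
  refine ⟨?_, ⟨M, ?_⟩, ?_, ?_, fun m => ?_⟩
  · refine (hh.aestronglyMeasurable (ae_ne_zero_sphereLaw hR)).congr ?_
    exact (ae_sphereProj_eq_self hR).mono fun x hx => congrArg f hx
  · filter_upwards [ae_ne_zero_sphereLaw hR, ae_sphereProj_eq_self hR] with x hx_ne hx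
    simpa [hx] using hh.norm_le x hx_ne
  · exact (ae_differentiableAt_comp_sphereProj_iff hR).2
      (stdGaussian_absolutelyContinuous.ae_le hh.ae_differentiableAt)
  · refine Integrable.of_bound (C := Module.finrank ℝ E * (K / R) ^ 2)
      measurable_hsSq_sphereFDeriv.aestronglyMeasurable ?_
    filter_upwards [ae_ne_zero_sphereLaw hR, ae_norm_eq_sphereLaw hR.le] with x hx_ne hx
    rw [Real.norm_of_nonneg (hsSq_nonneg _)]
    refine (hsSq_le _).trans ?_
    gcongr
    exact (hh.norm_fderiv_le hx_ne).trans_eq (by rw [hx])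
  · refine ((hh.sub_const m).steinPoincare hE).congr_ae .rfl (.of_forall fun x => ?_)
    exact fderiv_sub_const m

end RadiallyRegular

end RadiallyRegular

section Composition

open scoped Topology
open Filter Metric

variable {E : Type*} [NormedAddCommGroup E] [InnerProductSpace ℝ E] [FiniteDimensional ℝ E]
  {R K M : ℝ} {f g φ : E → E}

lemma hsSq_sphereFDeriv_comp_le (hφ : ScaleLipschitz K M φ) {x : E}
    (hgx : g (sphereProj R x) ≠ 0) (hφ_diff : DifferentiableAt ℝ φ (g (sphereProj R x)))
    (hg : DifferentiableAt ℝ (g ∘ sphereProj R) x) :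
    hsSq (sphereFDeriv R (φ ∘ g) x) ≤
      K ^ 2 * ((‖g (sphereProj R x)‖ ^ 2)⁻¹ * hsSq (sphereFDeriv R g x)) := by
  rw [sphereFDeriv_comp hφ_diff hg, ← mul_assoc, ← div_eq_mul_inv, ← div_pow]
  refine (hsSq_comp_le _ _).trans ?_
  gcongr
  · exact hsSq_nonneg _
  · exact hφ.norm_fderiv_le hgx

lemma norm_sphereFDeriv_annularCutoff_smul_comp_le (hφ : ScaleLipschitz K M φ) {B : ℝ} {k : ℕ}
    (hB : ∀ y : E, y ≠ 0 → ‖fderiv ℝ (annularCutoff k) y‖ ≤ B / ‖y‖) {x : E}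
    (hgx : g (sphereProj R x) ≠ 0) (hφ_diff : DifferentiableAt ℝ φ (g (sphereProj R x)))
    (hg : DifferentiableAt ℝ (g ∘ sphereProj R) x) :
    ‖sphereFDeriv R ((fun y => annularCutoff k y • φ y) ∘ g) x‖ ≤
      (K + B * M) * √((‖g (sphereProj R x)‖ ^ 2)⁻¹ * hsSq (sphereFDeriv R g x)) := by
  have hcutoff := hφ.norm_fderiv_annularCutoff_smul_le (hB _ hgx) hgx hφ_diff
  have hcutoff_diff := ((contDiff_annularCutoff k).differentiable (by simp) _).fun_smul hφ_diff
  rw [sphereFDeriv_comp hcutoff_diff hg]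
  calc _ ≤ _ := ContinuousLinearMap.opNorm_comp_le _ _
    _ ≤ (K + B * M) / ‖g (sphereProj R x)‖ * √(hsSq (sphereFDeriv R g x)) :=
        mul_le_mul hcutoff (Real.le_sqrt_of_sq_le (norm_sq_le_hsSq _)) (norm_nonneg _)
          ((norm_nonneg _).trans hcutoff)
    _ = _ := by
        rw [Real.sqrt_mul (by positivity), Real.sqrt_inv, Real.sqrt_sq (norm_nonneg _),
          ← mul_assoc, ← div_eq_mul_inv]

variable [MeasurableSpace E] [BorelSpace E]

lemma SteinPoincare.comp_sphereProj (hE : 3 ≤ Module.finrank ℝ E) (hR : 0 < R)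
    (hφ : ScaleLipschitz K M φ) (hφ_diff : ∀ y, y ≠ 0 → DifferentiableAt ℝ φ y)
    (hg : LocallyLipschitzOn (sphere 0 R) g) (hg_ne : ∀ᵐ x ∂sphereLaw E R, g x ≠ 0)
    (h_int : Integrable (fun x => (‖g x‖ ^ 2)⁻¹ * hsSq (sphereFDeriv R g x)) (sphereLaw E R))
    (m : E) :
    SteinPoincare (fun x => φ (g (sphereProj R x)) - m) (sphereFDeriv R (φ ∘ g)) := by
  have : Nontrivial E := Module.nontrivial_of_finrank_pos (R := ℝ) (by lia)
  obtain ⟨B, hB⟩ := exists_norm_fderiv_annularCutoff_le E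
  have hg_reg := RadiallyRegular.of_locallyLipschitzOn hE hR hg
  have hg_ne' := ae_of_ae_sphereLaw hg_ne
  have hg_diff := (ae_differentiableAt_comp_sphereProj_iff hR).1 hg_reg.differentiable
  have hcut_reg (k) : RadiallyRegular R ((fun y => annularCutoff k y • φ y) ∘ g) := by
    obtain ⟨C, hC⟩ := hφ.exists_lipschitzWith_annularCutoff_smul k
    obtain ⟨L, hL⟩ := hg.exists_lipschitzOnWith_of_compact (isCompact_sphere _ _)
    exact .of_locallyLipschitzOn hE hR fun _ _ =>
      ⟨_, _, self_mem_nhdsWithin, hC.comp_lipschitzOnWith hL⟩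
  refine .of_tendsto (M := M + ‖m‖)
    (w := fun x => (K + B * M) * √((‖g (sphereProj R x)‖ ^ 2)⁻¹ * hsSq (sphereFDeriv R g x)))
    (fun k => (hcut_reg k).steinPoincare m)
    (fun k => ((hcut_reg k).aestronglyMeasurable.comp_measurable
      (measurable_sphereProj R)).sub aestronglyMeasurable_const)
    (fun k => measurable_sphereFDeriv.aestronglyMeasurable)
    (fun k => .of_forall fun x => (norm_sub_le _ _).trans
      (by gcongr; exact hφ.norm_annularCutoff_smul_le k _)) (fun k => ?_) ?_ ?_ ?_
  · filter_upwards [hg_ne', hg_diff] with x hgx hx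
    exact norm_sphereFDeriv_annularCutoff_smul_comp_le hφ (hB k) hgx (hφ_diff _ hgx) hx
  · refine ((integrable_mul_hsSq_sphereFDeriv hE hR h_int).const_mul ((K + B * M) ^ 2)).congr
      (.of_forall fun x => ?_)
    simp only [mul_pow, Real.sq_sqrt (mul_nonneg (inv_nonneg.2 (sq_nonneg _)) (hsSq_nonneg _))]
  · filter_upwards [hg_ne'] with x hgx
    refine tendsto_const_nhds.congr' ?_
    filter_upwards [eventually_annularCutoff_smul_eventuallyEq φ hgx] with k hk
    exact congrArg (· - m) hk.eq_of_nhds.symm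
  · filter_upwards [hg_ne', hg_diff] with x hgx hx
    refine tendsto_const_nhds.congr' ?_
    filter_upwards [eventually_annularCutoff_smul_eventuallyEq φ hgx] with k hk
    exact (hk.comp_tendsto hx.continuousAt).symm.fderiv_eq

namespace RadiallyRegular

theorem comp (hE : 3 ≤ Module.finrank ℝ E) (hR : 0 < R) (hφ : ScaleLipschitz K M φ)
    (hφ_diff : ∀ y, y ≠ 0 → DifferentiableAt ℝ φ y)
    (hg : LocallyLipschitzOn (sphere 0 R) g) (hg_ne : ∀ᵐ x ∂sphereLaw E R, g x ≠ 0)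
    (h_int : Integrable (fun x => (‖g x‖ ^ 2)⁻¹ * hsSq (sphereFDeriv R g x)) (sphereLaw E R)) :
    RadiallyRegular R (φ ∘ g) := by
  have : Nontrivial E := Module.nontrivial_of_finrank_pos (R := ℝ) (by lia)
  have hg_reg := RadiallyRegular.of_locallyLipschitzOn hE hR hg
  refine ⟨?_, ⟨M, hg_ne.mono fun x hx => hφ.norm_le _ hx⟩, ?_, ?_,
    .comp_sphereProj hE hR hφ hφ_diff hg hg_ne h_int⟩
  · have hg_meas := hg_reg.aestronglyMeasurable.aemeasurable
    exact (hφ.aestronglyMeasurable ((ae_map_iff hg_meas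
      (measurableSet_singleton 0).compl).2 hg_ne)).comp_aemeasurable hg_meas
  · filter_upwards [hg_reg.differentiable, hg_ne, ae_sphereProj_eq_self hR] with x hx hgx hx_proj
    exact (hφ_diff _ (by rwa [hx_proj])).comp x hx
  · refine (h_int.const_mul (K ^ 2)).mono'
      measurable_hsSq_sphereFDeriv.aestronglyMeasurable ?_
    filter_upwards [hg_reg.differentiable, hg_ne, ae_sphereProj_eq_self hR] with x hx hgx hx_proj
    rw [← hx_proj] at hgx
    simpa only [Real.norm_of_nonneg (hsSq_nonneg _), hx_proj] using
      hsSq_sphereFDeriv_comp_le hφ hgx (hφ_diff _ hgx) hx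

theorem of_normalize (hE : 3 ≤ Module.finrank ℝ E) (hR : 0 < R)
    (hg : LocallyLipschitzOn (sphere 0 R) g)
    (hfg : ∀ x ∈ sphere (0 : E) R, g x ≠ 0 → f x = ‖g x‖⁻¹ • g x)
    (hg_ne : ∀ᵐ x ∂sphereLaw E R, g x ≠ 0)
    (h_int : Integrable (fun x => (‖g x‖ ^ 2)⁻¹ * hsSq (sphereFDeriv R g x)) (sphereLaw E R)) :
    RadiallyRegular R f := by
  have : Nontrivial E := Module.nontrivial_of_finrank_pos (R := ℝ) (by lia)
  refine (comp hE hR scaleLipschitz_inv_norm_smul (fun _ => differentiableAt_inv_norm_smul) hg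
    hg_ne h_int).congr hR ?_
  filter_upwards [hg_ne, ae_norm_eq_sphereLaw hR.le] with x hgx hx
  filter_upwards [self_mem_nhdsWithin,
    (hg.continuousOn x (mem_sphere_zero_iff_norm.2 hx)).eventually_ne hgx] with y hy hgy
  exact (hfg y hy hgy).symm

end RadiallyRegular

end Composition

section SphericalInequalities

variable {E : Type*} [NormedAddCommGroup E] [InnerProductSpace ℝ E] [FiniteDimensional ℝ E]
  [MeasurableSpace E] [BorelSpace E] {R : ℝ} {f : E → E}

lemma integral_sub_mul_sq {α : Type*} [MeasurableSpace α] {μ : Measure α} {a D : α → ℝ}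
    (ha : MemLp a 2 μ) (hD : MemLp D 2 μ) (c : ℝ) :
    ∫ x, (a x - c * D x) ^ 2 ∂μ =
      ∫ x, a x ^ 2 ∂μ - 2 * c * ∫ x, a x * D x ∂μ + c ^ 2 * ∫ x, D x ^ 2 ∂μ := by
  have haD : Integrable (fun x => a x * D x) μ := ha.integrable_mul hD
  rw [← integral_const_mul, ← integral_const_mul, ← integral_sub ha.integrable_sq
    (haD.const_mul _), ← integral_add (ha.integrable_sq.sub' (haD.const_mul _))
    (hD.integrable_sq.const_mul _)]
  congr with x
  ring

section Independence

variable [Nontrivial E] {q : ℝ → ℝ} {G : E → ℝ}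

lemma memLp_two_norm_mul_sphereProj (hq : Measurable q)
    (hq_int : Integrable (fun x : E => q ‖x‖ ^ 2) (stdGaussian E))
    (hG : MemLp G 2 (sphereLaw E R)) :
    MemLp (fun x => q ‖x‖ * G (sphereProj R x)) 2 (stdGaussian E) := by
  refine (memLp_two_iff_integrable_sq ((hq.comp measurable_norm).aestronglyMeasurable.fun_mul
    (hG.1.comp_measurable (measurable_sphereProj R)))).2 ?_
  simpa only [mul_pow, Function.comp_apply] using
    integrable_norm_mul_sphereProj (hq.pow_const 2) hq_int hG.integrable_sq

lemma integral_norm_mul_sphereProj_sq (hq : Measurable q)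
    (hG : AEStronglyMeasurable G (sphereLaw E R)) :
    ∫ x, (q ‖x‖ * G (sphereProj R x)) ^ 2 ∂stdGaussian E =
      (∫ x, q ‖x‖ ^ 2 ∂stdGaussian E) * ∫ x, G x ^ 2 ∂sphereLaw E R := by
  simpa only [mul_pow, Pi.pow_apply] using
    integral_norm_mul_sphereProj (hq.pow_const 2) (hG.pow 2)

end Independence

lemma integral_norm_mul_sub_inv_norm_mul_sq (hE : 3 ≤ Module.finrank ℝ E) (hR : R ≠ 0)
    {a D : E → ℝ} (ha : MemLp a 2 (sphereLaw E R)) (hD : MemLp D 2 (sphereLaw E R)) :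
    ∫ x, (‖x‖ / R * a (sphereProj R x) - R / ‖x‖ * D (sphereProj R x)) ^ 2 ∂stdGaussian E =
      Module.finrank ℝ E / R ^ 2 * ∫ x, a x ^ 2 ∂sphereLaw E R -
        2 * ∫ x, a x * D x ∂sphereLaw E R +
        R ^ 2 * ((Module.finrank ℝ E : ℝ) - 2)⁻¹ * ∫ x, D x ^ 2 ∂sphereLaw E R := by
  have : Nontrivial E := Module.nontrivial_of_finrank_pos (R := ℝ) (by lia)
  have hnorm_int : Integrable (fun x : E => (‖x‖ / R) ^ 2) (stdGaussian E) := by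
    simpa only [div_pow] using (integrable_norm_pow_stdGaussian 2).div_const (R ^ 2)
  have hinv_int : Integrable (fun x : E => (R / ‖x‖) ^ 2) (stdGaussian E) := by
    simpa only [div_eq_mul_inv, mul_pow, inv_pow] using
      (integrable_inv_norm_sq_stdGaussian hE).const_mul (R ^ 2)
  have hnorm : ∫ x : E, (‖x‖ / R) ^ 2 ∂stdGaussian E = Module.finrank ℝ E / R ^ 2 := by
    simp only [div_pow, integral_div, integral_norm_sq_stdGaussian]
  have hinv : ∫ x : E, (R / ‖x‖) ^ 2 ∂stdGaussian E =
      R ^ 2 * ((Module.finrank ℝ E : ℝ) - 2)⁻¹ := by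
    simp only [div_eq_mul_inv, mul_pow, inv_pow, integral_const_mul,
      integral_inv_norm_sq_stdGaussian hE]
  have hcross : ∫ x, ‖x‖ / R * a (sphereProj R x) * (R / ‖x‖ * D (sphereProj R x)) ∂stdGaussian E =
      ∫ x, a x * D x ∂sphereLaw E R := by
    rw [integral_sphereLaw (ha.1.fun_mul hD.1)]
    refine integral_congr_ae (ae_ne_zero_stdGaussian.mono fun x hx => ?_)
    have := norm_ne_zero_iff.2 hx
    field
  have hexpand := integral_sub_mul_sq
    (memLp_two_norm_mul_sphereProj (q := (· / R)) (by fun_prop) hnorm_int ha)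
    (memLp_two_norm_mul_sphereProj (q := (R / ·)) (by fun_prop) hinv_int hD) 1
  simp only [one_mul, one_pow, mul_one] at hexpand
  rw [hexpand, hcross, ← hnorm, ← hinv]
  congr 2
  · exact integral_norm_mul_sphereProj_sq (q := (· / R)) (by fun_prop) ha.1
  · exact integral_norm_mul_sphereProj_sq (q := (R / ·)) (by fun_prop) hD.1

lemma integral_sub_mul_sq_le_stdGaussian (hE : 3 ≤ Module.finrank ℝ E) (hR : R ≠ 0)
    {a D : E → ℝ} (ha : MemLp a 2 (sphereLaw E R)) (hD : MemLp D 2 (sphereLaw E R)) :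
    ∫ x, (a x - R ^ 2 * (Module.finrank ℝ E : ℝ)⁻¹ * D x) ^ 2 ∂sphereLaw E R ≤
      R ^ 2 * (Module.finrank ℝ E : ℝ)⁻¹ *
        ∫ x, (‖x‖ / R * a (sphereProj R x) - R / ‖x‖ * D (sphereProj R x)) ^ 2 ∂stdGaussian E := by
  have hdim : (3 : ℝ) ≤ Module.finrank ℝ E := mod_cast hE
  have hsq_nonneg : 0 ≤ ∫ x, D x ^ 2 ∂sphereLaw E R := integral_nonneg fun _ => sq_nonneg _
  rw [integral_sub_mul_sq ha hD, integral_norm_mul_sub_inv_norm_mul_sq hE hR ha hD]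
  set d : ℝ := (Module.finrank ℝ E : ℝ)
  set S := ∫ x, D x ^ 2 ∂sphereLaw E R
  have hinv : d⁻¹ * S ≤ (d - 2)⁻¹ * S := by
    gcongr <;> linarith
  have hscaled := mul_le_mul_of_nonneg_left hinv (by positivity : 0 ≤ R ^ 4 * d⁻¹)
  have hcancel : R ^ 2 * d⁻¹ * (d / R ^ 2) = 1 := by
    field
  linear_combination hscaled - (∫ x, a x ^ 2 ∂sphereLaw E R) * hcancel

lemma integral_hsSq_sphereFDeriv_stdGaussian (hE : 3 ≤ Module.finrank ℝ E) (hR : 0 < R) :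
    ∫ x, hsSq (sphereFDeriv R f x) ∂stdGaussian E =
      R ^ 2 * ((Module.finrank ℝ E : ℝ) - 2)⁻¹ *
        ∫ x, hsSq (sphereFDeriv R f x) ∂sphereLaw E R := by
  have : Nontrivial E := Module.nontrivial_of_finrank_pos (R := ℝ) (by lia)
  have hindep := integral_norm_mul_sphereProj (R := R) (q := fun r => R ^ 2 * (r ^ 2)⁻¹)
    (by fun_prop) (measurable_hsSq_sphereFDeriv (R := R) (f := f)).aestronglyMeasurable
  rw [integral_const_mul, integral_inv_norm_sq_stdGaussian hE] at hindep
  rw [← hindep]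
  exact integral_congr_ae (ae_ne_zero_stdGaussian.mono fun x hx => hsSq_sphereFDeriv hR hx)

lemma integral_norm_sub_sq_sphereLaw (hf : AEStronglyMeasurable f (sphereLaw E R)) (m : E) :
    ∫ x, ‖f x - m‖ ^ 2 ∂sphereLaw E R = ∫ x, ‖f (sphereProj R x) - m‖ ^ 2 ∂stdGaussian E :=
  integral_sphereLaw ((hf.sub aestronglyMeasurable_const).norm.pow 2)

namespace RadiallyRegular

theorem integral_norm_sub_integral_sq_le (hE : 3 ≤ Module.finrank ℝ E) (hR : 0 < R)
    (hf : RadiallyRegular R f) :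
    ∫ x, ‖f x - ∫ y, f y ∂sphereLaw E R‖ ^ 2 ∂sphereLaw E R ≤
      R ^ 2 * ((Module.finrank ℝ E : ℝ) - 2)⁻¹ *
        ∫ x, hsSq (sphereFDeriv R f x) ∂sphereLaw E R := by
  rw [← integral_hsSq_sphereFDeriv_stdGaussian hE hR,
    integral_norm_sub_sq_sphereLaw hf.aestronglyMeasurable,
    integral_sphereLaw hf.aestronglyMeasurable]
  simpa only [sub_zero] using (hf.steinPoincare 0).poincare

lemma memLp (hf : RadiallyRegular R f) (p : ENNReal) : MemLp f p (sphereLaw E R) :=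
  let ⟨M, hM⟩ := hf.bounded
  .of_bound hf.aestronglyMeasurable M hM

lemma memLp_abs_norm_sub (hf : RadiallyRegular R f) (c : ℝ) (p : ENNReal) :
    MemLp (fun x => |‖f x‖ - c|) p (sphereLaw E R) :=
  ((hf.memLp p).norm.sub (memLp_const c)).abs

theorem integral_abs_norm_sub_norm_integral_sq_le (hE : 3 ≤ Module.finrank ℝ E) (hR : 0 < R)
    (hf : RadiallyRegular R f) :
    ∫ x, |‖f x‖ - ‖∫ y, f y ∂sphereLaw E R‖| ^ 2 ∂sphereLaw E R ≤
      R ^ 2 * ((Module.finrank ℝ E : ℝ) - 2)⁻¹ *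
        ∫ x, hsSq (sphereFDeriv R f x) ∂sphereLaw E R := by
  refine (integral_mono_of_nonneg (.of_forall fun x => sq_nonneg _)
    ((hf.memLp 2).sub (memLp_const _)).norm.integrable_sq (.of_forall fun x => ?_)).trans
    (hf.integral_norm_sub_integral_sq_le hE hR)
  exact pow_le_pow_left₀ (abs_nonneg _) (abs_norm_sub_norm_le _ _) 2

lemma memLp_inner_sub (hf : RadiallyRegular R f) (hR : 0 ≤ R) [Nontrivial E] (m : E) :
    MemLp (fun x => inner ℝ (f x - m) x) 2 (sphereLaw E R) := by
  obtain ⟨M, hM⟩ := hf.bounded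
  refine .of_bound ((hf.aestronglyMeasurable.sub aestronglyMeasurable_const).inner
    aestronglyMeasurable_id) ((M + ‖m‖) * R) ?_
  filter_upwards [hM, ae_norm_eq_sphereLaw hR] with x hx hx_norm
  exact (norm_inner_le_norm _ _).trans
    (mul_le_mul ((norm_sub_le _ _).trans (by gcongr)) hx_norm.le (norm_nonneg _)
      (add_nonneg ((norm_nonneg _).trans hx) (norm_nonneg _)))

lemma memLp_traceCLM (hf : RadiallyRegular R f) :
    MemLp (fun x => traceCLM E (sphereFDeriv R f x)) 2 (sphereLaw E R) := by
  have hmeas : AEStronglyMeasurable (fun x => traceCLM E (sphereFDeriv R f x)) (sphereLaw E R) :=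
    ((traceCLM E).measurable.comp measurable_sphereFDeriv).aestronglyMeasurable
  refine (memLp_two_iff_integrable_sq hmeas).2 ((hf.integrable.const_mul (‖traceCLM E‖ ^ 2)).mono'
    (hmeas.pow 2) (.of_forall fun x => ?_))
  calc ‖traceCLM E (sphereFDeriv R f x) ^ 2‖
      ≤ (‖traceCLM E‖ * ‖sphereFDeriv R f x‖) ^ 2 := by
        rw [norm_pow]
        gcongr
        exact (traceCLM E).le_opNorm _
    _ ≤ ‖traceCLM E‖ ^ 2 * hsSq (sphereFDeriv R f x) := by
        rw [mul_pow]
        gcongr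
        exact norm_sq_le_hsSq _

lemma memLp_inner_sub_sub_traceCLM (hf : RadiallyRegular R f) (hR : 0 ≤ R) [Nontrivial E]
    (m : E) (c : ℝ) :
    MemLp (fun x => inner ℝ (f x - m) x - c * traceCLM E (sphereFDeriv R f x)) 2
      (sphereLaw E R) :=
  (hf.memLp_inner_sub hR m).sub (hf.memLp_traceCLM.const_mul c)

lemma integral_stein_le (hE : 3 ≤ Module.finrank ℝ E) (hR : 0 < R) (hf : RadiallyRegular R f) :
    ∫ x, (‖x‖ / R * inner ℝ (f (sphereProj R x) - ∫ y, f y ∂sphereLaw E R) (sphereProj R x) -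
        R / ‖x‖ * traceCLM E (sphereFDeriv R f (sphereProj R x))) ^ 2 ∂stdGaussian E ≤
      2 * (R ^ 2 * ((Module.finrank ℝ E : ℝ) - 2)⁻¹ *
        ∫ x, hsSq (sphereFDeriv R f x) ∂sphereLaw E R) := by
  have : Nontrivial E := Module.nontrivial_of_finrank_pos (R := ℝ) (by lia)
  have hstein := (hf.steinPoincare (∫ y, f y ∂sphereLaw E R)).stein
  have hpoincare := hf.integral_norm_sub_integral_sq_le hE hR
  rw [integral_norm_sub_sq_sphereLaw hf.aestronglyMeasurable] at hpoincare
  rw [integral_hsSq_sphereFDeriv_stdGaussian hE hR] at hstein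
  rw [two_mul]
  refine (integral_congr_ae ?_).trans_le (hstein.trans (add_le_add_left hpoincare _))
  filter_upwards [ae_ne_zero_stdGaussian] with x hx
  have hinner (v : E) : ‖x‖ / R * inner ℝ v (sphereProj R x) = inner ℝ v x := by
    have := norm_ne_zero_iff.2 hx
    rw [sphereProj, real_inner_smul_right]
    field
  rw [hinner, sphereFDeriv_eq_smul hR hx, map_smul, smul_eq_mul]

theorem integral_inner_sub_traceCLM_sq_le (hE : 3 ≤ Module.finrank ℝ E) (hR : 0 < R)
    (hf : RadiallyRegular R f) :
    ∫ x, (inner ℝ (f x - ∫ y, f y ∂sphereLaw E R) x -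
        R ^ 2 * (Module.finrank ℝ E : ℝ)⁻¹ * traceCLM E (sphereFDeriv R f x)) ^ 2 ∂sphereLaw E R ≤
      2 * R ^ 4 * ((Module.finrank ℝ E : ℝ) ^ 2 - 2 * Module.finrank ℝ E)⁻¹ *
        ∫ x, hsSq (sphereFDeriv R f x) ∂sphereLaw E R := by
  have : Nontrivial E := Module.nontrivial_of_finrank_pos (R := ℝ) (by lia)
  refine (integral_sub_mul_sq_le_stdGaussian hE hR.ne' (hf.memLp_inner_sub hR.le _)
    hf.memLp_traceCLM).trans ((mul_le_mul_of_nonneg_left (hf.integral_stein_le hE hR)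
      (by positivity)).trans_eq ?_)
  rw [sq (Module.finrank ℝ E : ℝ), ← sub_mul, mul_inv]
  ring

end RadiallyRegular

end SphericalInequalities

section Matrix

variable {n : ℕ} {R : ℝ} {f : EuclideanSpace ℝ (Fin n) → EuclideanSpace ℝ (Fin n)}
  {x : EuclideanSpace ℝ (Fin n)}

lemma frobSq_transpose (A : Matrix (Fin n) (Fin n) ℝ) : frobSq Aᵀ = frobSq A :=
  Finset.sum_comm

lemma sphereGrad_transpose_eq_toMatrix :
    (sphereGrad R f x)ᵀ = (sphereFDeriv R f x).toLinearMap.toMatrix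
      (EuclideanSpace.basisFun (Fin n) ℝ).toBasis (EuclideanSpace.basisFun (Fin n) ℝ).toBasis := by
  ext i j
  simp only [sphereGrad, Matrix.transpose_apply, Matrix.of_apply, sphereFDeriv,
    LinearMap.toMatrix_apply, OrthonormalBasis.coe_toBasis, EuclideanSpace.basisFun_apply,
    ContinuousLinearMap.coe_coe, OrthonormalBasis.coe_toBasis_repr_apply,
    EuclideanSpace.basisFun_repr]
  rfl

lemma trace_sphereGrad_transpose :
    (sphereGrad R f x)ᵀ.trace = traceCLM (EuclideanSpace ℝ (Fin n)) (sphereFDeriv R f x) := by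
  rw [traceCLM_apply, sphereGrad_transpose_eq_toMatrix, ← LinearMap.trace_eq_matrix_trace]

lemma frobSq_sphereGrad : frobSq (sphereGrad R f x) = hsSq (sphereFDeriv R f x) := by
  simp only [frobSq, hsSq_eq_sum_norm_sq (EuclideanSpace.basisFun (Fin n) ℝ),
    EuclideanSpace.real_norm_sq_eq, EuclideanSpace.basisFun_apply]
  rfl

lemma sphereGrad_transpose_mul_projPerp :
    (sphereGrad R f x)ᵀ * projPerp x = (sphereGrad R f x)ᵀ := by
  have hradial : (sphereGrad R f x)ᵀ *ᵥ x = 0 := by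
    have h := LinearMap.toMatrix_mulVec_repr (EuclideanSpace.basisFun (Fin n) ℝ).toBasis
      (EuclideanSpace.basisFun (Fin n) ℝ).toBasis (sphereFDeriv R f x).toLinearMap x
    rw [← sphereGrad_transpose_eq_toMatrix, ContinuousLinearMap.coe_coe, sphereFDeriv_self,
      map_zero] at h
    exact h
  have hrank_one : Matrix.of (fun i j => x i * x j) = Matrix.vecMulVec x x := rfl
  rw [projPerp, Matrix.mul_sub, Matrix.mul_one, Matrix.mul_smul, hrank_one,
    Matrix.mul_vecMulVec, hradial, Matrix.zero_vecMulVec, smul_zero, sub_zero]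

lemma frobSq_sphereGrad_transpose_mul_projPerp :
    frobSq ((sphereGrad R f x)ᵀ * projPerp x) = hsSq (sphereFDeriv R f x) := by
  rw [sphereGrad_transpose_mul_projPerp, frobSq_transpose, frobSq_sphereGrad]

lemma xiStein_sub_inner (m : EuclideanSpace ℝ (Fin n)) :
    xiStein R f x - inner ℝ m x = inner ℝ (f x - m) x -
      R ^ 2 * (n : ℝ)⁻¹ * traceCLM (EuclideanSpace ℝ (Fin n)) (sphereFDeriv R f x) := by
  rw [xiStein, sphereGrad_transpose_mul_projPerp, trace_sphereGrad_transpose, inner_sub_left]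
  ring

end Matrix

section Transfer

variable {Ω : Type*} [MeasurableSpace Ω] {P : Measure Ω}

section HasLaw

variable {X F : Type*} [MeasurableSpace X] {μ : Measure X} {z : Ω → X}

lemma ae_comp_iff_of_hasLaw [MeasurableSpace F] {g : X → F} {p : F → Prop}
    (hz : HasLaw z μ P) (hg : AEMeasurable g μ) (hp : Measurable p) :
    (∀ᵐ ω ∂P, p (g (z ω))) ↔ ∀ᵐ x ∂μ, p (g x) :=
  have hg_law : HasLaw g (μ.map g) μ := ⟨hg, rfl⟩
  ((hg_law.comp hz).ae_iff hp).trans (hg_law.ae_iff hp).symm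

variable [NormedAddCommGroup F]

lemma memLp_comp_iff_of_hasLaw {g : X → F} {p : ENNReal} (hz : HasLaw z μ P)
    (hg : AEStronglyMeasurable g μ) : MemLp (fun ω => g (z ω)) p P ↔ MemLp g p μ := by
  obtain rfl := hz.map_eq
  exact (memLp_map_measure_iff hg hz.aemeasurable).symm

lemma integrable_comp_iff_of_hasLaw {g : X → F} (hz : HasLaw z μ P)
    (hg : AEStronglyMeasurable g μ) : Integrable (fun ω => g (z ω)) P ↔ Integrable g μ := by
  simpa only [memLp_one_iff_integrable] using memLp_comp_iff_of_hasLaw (p := 1) hz hg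

end HasLaw

lemma sq_integral_le_integral_sq [IsProbabilityMeasure P] {Y : Ω → ℝ} (hY : MemLp Y 2 P) :
    (∫ ω, Y ω ∂P) ^ 2 ≤ ∫ ω, Y ω ^ 2 ∂P := by
  have h := variance_nonneg Y P
  rw [variance_eq_sub hY] at h
  exact sub_nonneg.1 h

lemma RadiallyRegular.of_hasLaw {n : ℕ} (hn : 3 ≤ n) {R : ℝ} (hR : 0 < R)
    {z : Ω → EuclideanSpace ℝ (Fin n)}
    {f : EuclideanSpace ℝ (Fin n) → EuclideanSpace ℝ (Fin n)}
    (hz : HasLaw z (sphereLaw (EuclideanSpace ℝ (Fin n)) R) P)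
    (hf : LocallyLipschitzOn (Metric.sphere 0 R) f ∨
      ∃ g : EuclideanSpace ℝ (Fin n) → EuclideanSpace ℝ (Fin n),
        LocallyLipschitzOn (Metric.sphere 0 R) g ∧
        (∀ x ∈ Metric.sphere (0 : EuclideanSpace ℝ (Fin n)) R,
          g x ≠ 0 → f x = ‖g x‖⁻¹ • g x) ∧
        (∀ᵐ ω ∂P, g (z ω) ≠ 0) ∧
        Integrable (fun ω => (‖g (z ω)‖ ^ 2)⁻¹ * frobSq (sphereGrad R g (z ω))) P) :
    RadiallyRegular R f := by
  have hE : 3 ≤ Module.finrank ℝ (EuclideanSpace ℝ (Fin n)) := by simpa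
  obtain hf | ⟨g, hg, hfg, hg_ne, h_int⟩ := hf
  · exact .of_locallyLipschitzOn hE hR hf
  · have hg_meas := (RadiallyRegular.of_locallyLipschitzOn hE hR hg).aestronglyMeasurable
    simp only [frobSq_sphereGrad] at h_int
    refine .of_normalize hE hR hg hfg
      ((ae_comp_iff_of_hasLaw hz hg_meas.aemeasurable (p := (· ≠ 0))
        (measurableSet_setOfPred.1 (measurableSet_singleton 0).compl)).1 hg_ne)
      ((integrable_comp_iff_of_hasLaw hz (AEMeasurable.aestronglyMeasurable ?_)).1 h_int)
    exact (hg_meas.norm.aemeasurable.pow_const 2).inv.mul measurable_hsSq_sphereFDeriv.aemeasurable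

end Transfer

theorem mainTheorem4 {Ω : Type*} [MeasurableSpace Ω] (P : Measure Ω) [IsProbabilityMeasure P]
    (n : ℕ) (hn : 3 ≤ n) (R : ℝ) (hR : 0 < R)
    (z : Ω → EuclideanSpace ℝ (Fin n)) (hz : HasLaw z (sphereUniform n R) P)
    (f : EuclideanSpace ℝ (Fin n) → EuclideanSpace ℝ (Fin n))
    (hf :
      (LocallyLipschitzOn (Metric.sphere 0 R) f ∧
        Integrable (fun ω => frobSq (sphereGrad R f (z ω))ᵀ) P) ∨
      (∃ g : EuclideanSpace ℝ (Fin n) → EuclideanSpace ℝ (Fin n),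
        LocallyLipschitzOn (Metric.sphere 0 R) g ∧
        (∀ x ∈ Metric.sphere (0 : EuclideanSpace ℝ (Fin n)) R,
          g x ≠ 0 → f x = ‖g x‖⁻¹ • g x) ∧
        (∀ᵐ ω ∂P, g (z ω) ≠ 0) ∧
        Integrable (fun ω => (‖g (z ω)‖ ^ 2)⁻¹ * frobSq (sphereGrad R g (z ω))) P)) :
    -- all quantities below are well defined
    (∀ᵐ ω ∂P, DifferentiableAt ℝ (radialExt R f) (z ω)) ∧
    Integrable (fun ω => f (z ω)) P ∧
    Integrable (fun ω => frobSq ((sphereGrad R f (z ω))ᵀ * projPerp (z ω))) P ∧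
    Integrable (fun ω => (xiStein R f (z ω) - inner ℝ (∫ ω', f (z ω') ∂P) (z ω)) ^ 2) P ∧
    Integrable (fun ω => |‖f (z ω)‖ - ‖∫ ω', f (z ω') ∂P‖| ^ 2) P ∧
    -- first inequality
    (∫ ω, (xiStein R f (z ω) - inner ℝ (∫ ω', f (z ω') ∂P) (z ω)) ^ 2 ∂P ≤
      2 * R ^ 4 * ((n : ℝ) ^ 2 - 2 * n)⁻¹ *
        ∫ ω, frobSq ((sphereGrad R f (z ω))ᵀ * projPerp (z ω)) ∂P) ∧
    -- second inequality, for the squared mean deviation and for the mean squared deviation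
    ((∫ ω, |‖f (z ω)‖ - ‖∫ ω', f (z ω') ∂P‖| ∂P) ^ 2 ≤
      R ^ 2 * ((n : ℝ) - 2)⁻¹ *
        ∫ ω, frobSq ((sphereGrad R f (z ω))ᵀ * projPerp (z ω)) ∂P) ∧
    (∫ ω, |‖f (z ω)‖ - ‖∫ ω', f (z ω') ∂P‖| ^ 2 ∂P ≤
      R ^ 2 * ((n : ℝ) - 2)⁻¹ *
        ∫ ω, frobSq ((sphereGrad R f (z ω))ᵀ * projPerp (z ω)) ∂P) := by
  have hE : 3 ≤ Module.finrank ℝ (EuclideanSpace ℝ (Fin n)) := by simpa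
  have := Module.nontrivial_of_finrank_pos (zero_lt_three.trans_le hE)
  change HasLaw z (sphereLaw _ R) P at hz
  have hreg : RadiallyRegular R f := .of_hasLaw hn hR hz (hf.imp_left And.left)
  have hmean : ∫ ω, f (z ω) ∂P = ∫ x, f x ∂sphereLaw _ R :=
    hz.integral_comp hreg.aestronglyMeasurable
  have hgrad : ∫ ω, hsSq (sphereFDeriv R f (z ω)) ∂P = _ := hz.integral_comp hreg.integrable.1
  simp only [hmean, xiStein_sub_inner, frobSq_sphereGrad_transpose_mul_projPerp, hgrad]
  have hstein := hreg.memLp_inner_sub_sub_traceCLM hR.le (∫ x, f x ∂sphereLaw _ R)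
    (R ^ 2 * (n : ℝ)⁻¹)
  have hdev := hreg.memLp_abs_norm_sub ‖∫ x, f x ∂sphereLaw _ R‖ 2
  have hdev_comp := (memLp_comp_iff_of_hasLaw hz hdev.1).2 hdev
  have hstein_le := hreg.integral_inner_sub_traceCLM_sq_le hE hR
  have hdev_le := (hz.integral_comp (hdev.1.pow 2)).trans_le
    (hreg.integral_abs_norm_sub_norm_integral_sq_le hE hR)
  rw [finrank_euclideanSpace_fin] at hstein_le hdev_le
  exact ⟨ae_of_ae_map hz.aemeasurable (hz.map_eq ▸ hreg.differentiable),
    (integrable_comp_iff_of_hasLaw hz hreg.aestronglyMeasurable).2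
      ((hreg.memLp 1).integrable le_rfl),
    (integrable_comp_iff_of_hasLaw hz hreg.integrable.1).2 hreg.integrable,
    ((memLp_comp_iff_of_hasLaw hz hstein.1).2 hstein).integrable_sq,
    hdev_comp.integrable_sq, (hz.integral_comp (hstein.1.pow 2)).trans_le hstein_le,
    (sq_integral_le_integral_sq hdev_comp).trans hdev_le, hdev_le⟩
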